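/- **Notation.** A partition in $(N,M)$ is a sequence of $N$ integers $M\ge x_N\ge x_{N-1}\ge\cdots\ge x_1\ge 0$; its weight $\mathrm{wt}(x)$ is the sum of its parts. Put $x_0=0$ and $x_{N+1}=M$. For non-negative integers $a,b,\alpha,\beta$ with $a+b>0$ and $\alpha+\beta>0$ let $$R(N,M,a,b,\alpha,\beta)=\sum_{(x,y)}q^{\mathrm{wt}(x)+\mathrm{wt}(y)},$$ the sum being over all pairs $(x,y)$ of partitions in $(N,M)$ such that $y_i-x_{i+1-a}\ge 1-\alpha$ for $a\le i\le N$ and $x_i-y_{i+1-b}\ge 1-\beta$ for $b\le i\le N$. Let $(q)_n=\prod_{i=1}^n(1-q^i)$, $(q)_\infty=\prod_{i\ge1}(1-q^i)$, and let $\left[{P\atop n}\right]=\frac{(q)_P}{(q)_n(q)_{P-n}}$ if $P\ge n\ge 0$ and $0$ otherwise. For coprime non-negative integers $s,r$, the continued fraction of $(s:r)$ is the empty sequence if $(s:r)=(1:0)$, and otherwise $(c_1,c_2,\ldots)$ with $c_1=\lfloor s/r\rfloor$ and $(c_2,c_3,\ldots)$ the continued fraction of $(r:s-c_1r)$. In addition,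 $(c_1,\ldots,c_{m-1},1)$ with $m>1$ is regarded as a continued fraction of the pair with continued fraction $(c_1,\ldots,c_{m-1}+1)$. **Theorem.** Let $p$ and $p'$ be positive coprime integers such that $(p':p)$ has continued fraction $(c_1,\ldots,c_{t-1},c_t+2)$ with $t\ge 1$ and all $c_k\ge 0$, and let $(s:r)$ have continued fraction $(c_1,\ldots,c_{t-1})$. Then $|p'r-ps|=1$, and for all integers $N,M\ge 0$ $$R(N,M,r,p-r,s,p'-s)=\sum q^{\sum_{k=1}^{t}\sum_{i=1}^{c_k}n_{k,i}^2}\prod_{k=1}^{t}\prod_{i=1}^{c_k}\left[{2\bigl(w_k-\sum_{j=1}^{i}n_{k,j}\bigr)+n_{k,i-1}+n_{k,i}\atop n_{k,i-1}-n_{k,i}}\right].$$ Here the (finite) sum is over all sequences $n^{(1)},\ldots,n^{(t)}$ of partitions $n^{(k)}=(n_{k,1},\ldots,n_{k,c_k})$ with exactly $c_k$ parts (zero parts allowed) such that, for $1\le k\le t$, $n_{k,0}\ge n_{k,1}\ge\cdots\ge n_{k,c_k}\ge 0$ and $\mathrm{wt}(n^{(k)})\le w_k$, and such that moreover $\mathrm{wt}(n^{(t)})=w_t$,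 where $n_{1,0}=N$, $w_1=M$, and, for $2\le k\le t$, $n_{k,0}=w_{k-1}-\mathrm{wt}(n^{(k-1)})$ and $w_k=n_{k-1,c_{k-1}}$. Furthermore, $R(N,M,r,p-r,s,p'-s)$ is a two-parameter finitisation of $\chi^{p,p'}_{r,s}$: as $N,M\to\infty$ it tends, coefficient by coefficient, to $\frac{1}{(q)_\infty}\chi^{p,p'}_{r,s}$, where $$\chi^{p,p'}_{r,s}=\frac1{(q)_\infty}\sum_{k=-\infty}^{\infty}\left(q^{k^2pp'+k(p'r-ps)}-q^{(kp+r)(kp'+s)}\right).$$ -/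

import Mathlib

namespace Burge

open PowerSeries

/-! ### Restricted partition pairs -/

/-- A partition `p` in `(N, M)` is stored as its `N` parts `M ≥ p_N ≥ ⋯ ≥ p_1 ≥ 0`, with
`p ⟨i - 1, _⟩ = p_i`. -/
def IsPartitionIn (N M : ℕ) (p : Fin N → Fin (M + 1)) : Prop := Monotone p

/-- The part `p_i` of a partition in `(N, M)`, with the boundary values `p_0 = 0` and
`p_{N+1} = M`. -/
def part (N M : ℕ) (p : Fin N → Fin (M + 1)) (i : ℤ) : ℤ :=
  if i ≤ 0 then 0
  else if h : (i - 1).toNat < N then ((p ⟨(i - 1).toNat, h⟩ : ℕ) : ℤ)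
  else M

/-- The weight of a partition: the sum of its parts. -/
def wt (N M : ℕ) (p : Fin N → Fin (M + 1)) : ℕ := ∑ i, (p i : ℕ)

/-- The pair `(x, y)` of partitions in `(N₁, M₁) × (N₂, M₂)` is restricted:
`y_i - x_{i+1-a} ≥ 1 - α` for `a ≤ i ≤ N₂` and `x_i - y_{i+1-b} ≥ 1 - β` for `b ≤ i ≤ N₁`.

With the boundary values `x_0 = y_0 = 0`, `x_{N₁+1} = M₁`, `y_{N₂+1} = M₂`, and for parameters
with `-a ≤ N₁ - N₂ ≤ b`, the values of `i` for which all subscripts are those of actual parts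
give the generic inequalities, and the remaining ones are the special cases:
`x_1 ≤ α - 1` if `a = 0`; `y_1 ≤ β - 1` if `b = 0`;
`y_{N₂} ≥ M₁ - α + 1` if `a = N₂ - N₁`; `x_{N₁} ≥ M₂ - β + 1` if `b = N₁ - N₂`. -/
def IsRestricted (N₁ M₁ N₂ M₂ : ℕ) (a b α β : ℤ)
    (x : Fin N₁ → Fin (M₁ + 1)) (y : Fin N₂ → Fin (M₂ + 1)) : Prop :=
  IsPartitionIn N₁ M₁ x ∧ IsPartitionIn N₂ M₂ y ∧
  (∀ i : ℤ, a ≤ i → i ≤ N₂ → 1 - α ≤ part N₂ M₂ y i - part N₁ M₁ x (i + 1 - a)) ∧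
  (∀ i : ℤ, b ≤ i → i ≤ N₁ → 1 - β ≤ part N₁ M₁ x i - part N₂ M₂ y (i + 1 - b))

open Classical in
/-- The generating function `R(N₁, M₁, N₂, M₂, a, b, α, β)` of the restricted partition pairs,
a polynomial in `q`. -/
noncomputable def pairGenFun (N₁ M₁ N₂ M₂ : ℕ) (a b α β : ℤ) : Polynomial ℚ :=
  ∑ z : (Fin N₁ → Fin (M₁ + 1)) × (Fin N₂ → Fin (M₂ + 1)) with
      IsRestricted N₁ M₁ N₂ M₂ a b α β z.1 z.2,
    Polynomial.X ^ (wt N₁ M₁ z.1 + wt N₂ M₂ z.2)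

/-- `R(N, M, a, b, α, β) = R(N, M, N, M, a, b, α, β)`. -/
noncomputable def R (N M : ℕ) (a b α β : ℤ) : Polynomial ℚ := pairGenFun N M N M a b α β

/-! ### Gaussian polynomials -/

/-- `(q)_n = (1 - q)(1 - q²)⋯(1 - qⁿ)`. -/
noncomputable def qFac (n : ℕ) : ℚ⟦X⟧ := ∏ i ∈ Finset.range n, (1 - (X : ℚ⟦X⟧) ^ (i + 1))

/-- The Gaussian polynomial `(q)_P / ((q)_n (q)_{P-n})` if `P ≥ n ≥ 0`, and `0` otherwise. The
quotient is taken in the ring of formal power series, where each `(q)_m` is invertible. -/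
noncomputable def gauss (P n : ℤ) : ℚ⟦X⟧ :=
  if 0 ≤ n ∧ n ≤ P then qFac P.toNat * (qFac n.toNat * qFac (P - n).toNat)⁻¹ else 0

/-! ### Continued fractions -/

/-- The continued fraction of the pair `(s : r)` by the Euclidean algorithm: `()` for `(1 : 0)`,
and otherwise `c₁ = ⌊s / r⌋` followed by the continued fraction of `(r : s - c₁ r)`. -/
def contFrac (s r : ℕ) : List ℕ :=
  if h : r = 0 then [] else (s / r) :: contFrac r (s % r)
termination_by r
decreasing_by exact Nat.mod_lt _ (Nat.pos_of_ne_zero h)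

/-- `l` is a continued fraction for the coprime pair `(s : r)`: either the one given by the
Euclidean algorithm, or, if that is `(c_1, …, c_{m-1} + 1)`, the sequence
`(c_1, …, c_{m-1}, 1)`, `m > 1`. -/
def IsContFrac (s r : ℕ) (l : List ℕ) : Prop :=
  Nat.Coprime s r ∧
    (contFrac s r = l ∨ ∃ (l' : List ℕ) (c : ℕ), l = l' ++ [c, 1] ∧ contFrac s r = l' ++ [c + 1])

/-! ### Sequences of partitions and the fermionic sum

Sequences are numbered from zero in the code: entry `k` of `c` is `c_{k+1}`, entry `k` of `n` is
the partition `n^{(k+1)}`, written as the list `(n_{k+1,1}, n_{k+1,2}, …)`. -/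

/-- The number `c_{k+1}`. -/
def cAt (c : List ℕ) (k : ℕ) : ℕ := c.getD k 0

/-- The partition `n^{(k+1)}`. -/
def parAt (n : List (List ℕ)) (k : ℕ) : List ℕ := n.getD k []

/-- The pair `(n_{k+1,0}, w_{k+1})`, given by `(n_{1,0}, w_1) = (N, M)`,
`n_{k+1,0} = w_k - wt(n^{(k)})` and `w_{k+1} = n_{k,c_k}` (which is `n_{k,0}` if `c_k = 0`). -/
def bounds (c : List ℕ) (N M : ℕ) (n : List (List ℕ)) : ℕ → ℕ × ℕ
  | 0 => (N, M)
  | k + 1 =>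
    ((bounds c N M n k).2 - (parAt n k).sum,
      ((bounds c N M n k).1 :: parAt n k).getD (cAt c k) 0)

/-- The number `n_{k+1,i}`, for `i ≥ 0`. -/
def nAt (c : List ℕ) (N M : ℕ) (n : List (List ℕ)) (k i : ℕ) : ℕ :=
  ((bounds c N M n k).1 :: parAt n k).getD i 0

/-- The number `w_{k+1}`. -/
def wAt (c : List ℕ) (N M : ℕ) (n : List (List ℕ)) (k : ℕ) : ℕ := (bounds c N M n k).2

/-- The sequences `n^{(1)}, …, n^{(t)}`, where `t` is the length of `c`, such that `n^{(k)}` is a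
partition in `(c_k, n_{k,0})` (that is, it has `c_k` parts and
`n_{k,0} ≥ n_{k,1} ≥ ⋯ ≥ n_{k,c_k}`) with `wt(n^{(k)}) ≤ w_k` for `1 ≤ k ≤ t`, and
`wt(n^{(t)}) = w_t`. -/
def partitionSeqs (c : List ℕ) (N M : ℕ) : Set (List (List ℕ)) :=
  {n | n.length = c.length ∧
    (∀ k < c.length,
      (parAt n k).length = cAt c k ∧
      (∀ i < cAt c k, nAt c N M n k (i + 1) ≤ nAt c N M n k i) ∧
      (parAt n k).sum ≤ wAt c N M n k) ∧
    (parAt n (c.length - 1)).sum = wAt c N M n (c.length - 1)}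

/-- The summand
`q^{∑_k ∑_i n_{k,i}²} ∏_k ∏_i [2 (w_k - ∑_{j ≤ i} n_{k,j}) + n_{k,i-1} + n_{k,i}, n_{k,i-1} - n_{k,i}]`
with `1 ≤ k ≤ t` and `1 ≤ i ≤ c_k`. -/
noncomputable def summand (c : List ℕ) (N M : ℕ) (n : List (List ℕ)) : ℚ⟦X⟧ :=
  X ^ (∑ k ∈ Finset.range c.length, ∑ i ∈ Finset.Icc 1 (cAt c k), nAt c N M n k i ^ 2) *
  ∏ k ∈ Finset.range c.length, ∏ i ∈ Finset.Icc 1 (cAt c k),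
    gauss
      (2 * ((wAt c N M n k : ℤ) - ∑ j ∈ Finset.Icc 1 i, (nAt c N M n k j : ℤ))
        + nAt c N M n k (i - 1) + nAt c N M n k i)
      ((nAt c N M n k (i - 1) : ℤ) - nAt c N M n k i)

/-! ### Virasoro characters -/

open scoped PowerSeries.WithPiTopology in
/-- `(q)_∞ = ∏_{i ≥ 1} (1 - q^i)`. -/
noncomputable def qInf : ℚ⟦X⟧ := ∏' i : ℕ, (1 - (X : ℚ⟦X⟧) ^ (i + 1))

/-- The character
`χ^{p,p'}_{r,s} = (q)_∞⁻¹ ∑_{k ∈ ℤ} (q^{k²pp' + k(p'r - ps)} - q^{(kp + r)(kp' + s)})`;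
the coefficient of `q^m` in the sum over `k` is a finite sum. -/
noncomputable def virasoroChar (p p' r s : ℕ) : ℚ⟦X⟧ :=
  qInf⁻¹ * PowerSeries.mk fun m : ℕ => ∑ᶠ k : ℤ,
    ((if k ^ 2 * (p * p') + k * (p' * r - p * s) = (m : ℤ) then (1 : ℚ) else 0)
      - (if (k * p + r) * (k * p' + s) = (m : ℤ) then (1 : ℚ) else 0))

end Burge

namespace Burge

open Polynomial

/-! ### Gaussian polynomials over `ℚ[q]` -/

/-- The Gaussian polynomial `[P, n]` as an element of `ℚ[q]`. -/
noncomputable def gaussPoly : ℕ → ℕ → ℚ[X]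
  | _, 0 => 1
  | 0, _ + 1 => 0
  | P + 1, n + 1 => gaussPoly P n + X ^ (n + 1) * gaussPoly P (n + 1)

/-- `(q)_n` as an element of `ℚ[q]`. -/
noncomputable def qFacPoly (n : ℕ) : ℚ[X] := ∏ i ∈ Finset.range n, (1 - X ^ (i + 1))

@[simp] lemma gaussPoly_zero_right (P : ℕ) : gaussPoly P 0 = 1 := by
  cases P <;> rfl

@[simp] lemma gaussPoly_zero_succ (n : ℕ) : gaussPoly 0 (n + 1) = 0 := rfl

lemma gaussPoly_succ_succ (P n : ℕ) :
    gaussPoly (P + 1) (n + 1) = gaussPoly P n + X ^ (n + 1) * gaussPoly P (n + 1) := rfl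

lemma gaussPoly_of_lt {P n : ℕ} (h : P < n) : gaussPoly P n = 0 := by
  induction P generalizing n with
  | zero =>
    obtain ⟨k, rfl⟩ := Nat.exists_eq_succ_of_ne_zero (by omega : n ≠ 0)
    rfl
  | succ P ih =>
    obtain ⟨k, rfl⟩ := Nat.exists_eq_succ_of_ne_zero (by omega : n ≠ 0)
    rw [Nat.succ_eq_add_one, gaussPoly_succ_succ, ih (by omega), ih (by omega)]
    simp

@[simp] lemma gaussPoly_self (P : ℕ) : gaussPoly P P = 1 := by
  induction P with
  | zero => rfl
  | succ P ih => rw [gaussPoly_succ_succ, ih, gaussPoly_of_lt (by omega)]; simp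

lemma qFacPoly_succ (n : ℕ) : qFacPoly (n + 1) = qFacPoly n * (1 - X ^ (n + 1)) :=
  Finset.prod_range_succ _ _

@[simp] lemma qFacPoly_zero : qFacPoly 0 = 1 := rfl

lemma qFacPoly_ne_zero (n : ℕ) : qFacPoly n ≠ 0 := by
  refine Finset.prod_ne_zero_iff.2 fun i _ h => ?_
  have := congrArg (Polynomial.eval 0) h
  simp at this

lemma gaussPoly_mul (n m : ℕ) :
    gaussPoly (n + m) n * (qFacPoly n * qFacPoly m) = qFacPoly (n + m) := by
  induction n generalizing m with
  | zero => simp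
  | succ n ihn =>
    induction m with
    | zero => simp
    | succ m ihm =>
      have h1 := ihn (m + 1)
      rw [show n + 1 + (m + 1) = (n + m + 1) + 1 by ring, gaussPoly_succ_succ, qFacPoly_succ (_ + 1)]
      rw [show n + (m + 1) = n + m + 1 by ring] at h1
      rw [show n + 1 + m = n + m + 1 by ring] at ihm
      have e1 : gaussPoly (n + m + 1) n * (qFacPoly (n + 1) * qFacPoly (m + 1)) =
          (1 - X ^ (n + 1)) * qFacPoly (n + m + 1) := by
        rw [qFacPoly_succ n, ← h1]; ring
      have e2 : gaussPoly (n + m + 1) (n + 1) * (qFacPoly (n + 1) * qFacPoly (m + 1)) =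
          (1 - X ^ (m + 1)) * qFacPoly (n + m + 1) := by
        rw [qFacPoly_succ m, ← ihm]; ring
      rw [add_mul, mul_assoc, e1, e2]
      ring

lemma gaussPoly_symm (n m : ℕ) : gaussPoly (n + m) n = gaussPoly (n + m) m := by
  have h1 := gaussPoly_mul n m
  have h2 := gaussPoly_mul m n
  rw [add_comm m n, mul_comm (qFacPoly m), ← h1] at h2
  exact (mul_right_cancel₀ (mul_ne_zero (qFacPoly_ne_zero _) (qFacPoly_ne_zero _)) h2).symm

/-- The other form of the Pascal recurrence. -/
lemma gaussPoly_pascal (n m : ℕ) :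
    gaussPoly (n + 1 + (m + 1)) (n + 1) =
      gaussPoly (n + 1 + m) (n + 1) + X ^ (m + 1) * gaussPoly (n + (m + 1)) n := by
  rw [gaussPoly_symm, show n + 1 + (m + 1) = (n + 1 + m) + 1 by ring, gaussPoly_succ_succ,
    ← gaussPoly_symm, show n + 1 + m = n + (m + 1) by ring, ← gaussPoly_symm n (m + 1)]

/-- Trinomial revision. -/
lemma gaussPoly_mul_gaussPoly (Q m j : ℕ) :
    gaussPoly Q m * gaussPoly (Q - m) j = gaussPoly Q (m + j) * gaussPoly (m + j) m := by
  by_cases h : m + j ≤ Q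
  · obtain ⟨l, rfl⟩ := Nat.exists_eq_add_of_le h
    have h1 := gaussPoly_mul m (j + l)
    have h2 := gaussPoly_mul j l
    have h3 := gaussPoly_mul (m + j) l
    have h4 := gaussPoly_mul m j
    rw [show m + j + l - m = j + l by omega]
    rw [show m + (j + l) = m + j + l by ring] at h1
    refine mul_right_cancel₀ (mul_ne_zero (qFacPoly_ne_zero m)
      (mul_ne_zero (qFacPoly_ne_zero j) (qFacPoly_ne_zero l))) ?_
    trans qFacPoly (m + j + l)
    · rw [← h1, ← h2]; ring
    · rw [← h3, ← h4]; ring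
  · rw [gaussPoly_of_lt (by omega : Q < m + j)]
    by_cases hm : m ≤ Q
    · rw [gaussPoly_of_lt (by omega : Q - m < j)]; simp
    · rw [gaussPoly_of_lt (by omega : Q < m)]; simp

/-- The `q`-Vandermonde identity. -/
lemma gaussPoly_vandermonde (A B n : ℕ) :
    gaussPoly (A + B) n = ∑ j ∈ Finset.range (n + 1),
      X ^ ((A - j) * (n - j)) * gaussPoly A j * gaussPoly B (n - j) := by
  induction A generalizing n with
  | zero =>
    rw [Finset.sum_range_succ', Finset.sum_eq_zero]
    · simp
    · intro j _; simp
  | succ A ih =>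
    cases n with
    | zero => simp
    | succ n =>
      rw [show A + 1 + B = A + B + 1 by ring, gaussPoly_succ_succ, ih n, ih (n + 1),
        Finset.sum_range_succ' _ (n + 1), Finset.sum_range_succ' _ (n + 1), mul_add,
        ← add_assoc, Finset.mul_sum, ← Finset.sum_add_distrib]
      congr 1
      · refine Finset.sum_congr rfl fun j hj => ?_
        have hj' : j ≤ n := by simpa [Nat.lt_succ_iff] using hj
        rw [gaussPoly_succ_succ, show A + 1 - (j + 1) = A - j by omega,
          show n + 1 - (j + 1) = n - j by omega]
        by_cases hA : j + 1 ≤ A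
        · obtain ⟨a, rfl⟩ := Nat.exists_eq_add_of_le hA
          obtain ⟨k, rfl⟩ := Nat.exists_eq_add_of_le hj'
          rw [show j + 1 + a - j = a + 1 by omega, show j + 1 + a - (j + 1) = a by omega,
            show j + k - j = k by omega]
          ring
        · rw [gaussPoly_of_lt (by omega : A < j + 1)]; ring
      · simp only [gaussPoly_zero_right, Nat.sub_zero]
        ring

/-- The `q`-Pfaff–Saalschütz identity. -/
lemma gaussPoly_saalschutz (L P Q e : ℕ) :
    ∑ m ∈ Finset.range (L + 1), X ^ (m * (m + e)) * gaussPoly (P + Q + L - m) (L - m) *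
        gaussPoly P (m + e) * gaussPoly Q m =
      gaussPoly (L + P) (L + e) * gaussPoly (L + Q + e) L := by
  have step : ∀ m ∈ Finset.range (L + 1),
      X ^ (m * (m + e)) * gaussPoly (P + Q + L - m) (L - m) * gaussPoly P (m + e) *
        gaussPoly Q m = ∑ t ∈ Finset.Ico m (L + 1), X ^ (m * (m + e)) * gaussPoly P (m + e) *
          gaussPoly t m * (gaussPoly Q t * (X ^ ((Q - t) * (L - t)) *
            gaussPoly (P + L) (L - t))) := by
    intro m hm
    have hm' : m ≤ L := by simpa [Nat.lt_succ_iff] using hm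
    by_cases hQ : m ≤ Q
    · rw [show P + Q + L - m = (Q - m) + (P + L) by omega, gaussPoly_vandermonde,
        Finset.sum_Ico_eq_sum_range, show L + 1 - m = L - m + 1 by omega,
        Finset.mul_sum, Finset.sum_mul, Finset.sum_mul]
      refine Finset.sum_congr rfl fun j _ => ?_
      have := gaussPoly_mul_gaussPoly Q m j
      rw [Nat.sub_sub, Nat.sub_sub]
      linear_combination X ^ (m * (m + e)) * gaussPoly P (m + e) *
        X ^ ((Q - (m + j)) * (L - (m + j))) * gaussPoly (P + L) (L - (m + j)) * this
    · rw [gaussPoly_of_lt (by omega : Q < m), mul_zero, Finset.sum_eq_zero]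
      intro t ht
      rw [gaussPoly_of_lt (by have := Finset.mem_Ico.1 ht; omega : Q < t)]
      ring
  rw [Finset.sum_congr rfl step, Finset.sum_comm' (t' := Finset.range (L + 1))
    (s' := fun t => Finset.range (t + 1)) (by intro x y; simp; omega)]
  have inner : ∀ t, ∑ m ∈ Finset.range (t + 1), X ^ (m * (m + e)) * gaussPoly P (m + e) *
      gaussPoly t m = gaussPoly (P + t) (t + e) := by
    intro t
    rw [add_comm P t, gaussPoly_vandermonde, show t + e + 1 = (t + 1) + e by ring,
      Finset.sum_range_add _ (t + 1) e, Finset.sum_eq_zero (s := Finset.range e), add_zero,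
      ← Finset.sum_range_reflect]
    · refine Finset.sum_congr rfl fun j hj => ?_
      have hj' : j ≤ t := by simpa [Nat.lt_succ_iff] using hj
      obtain ⟨k, rfl⟩ := Nat.exists_eq_add_of_le hj'
      rw [show j + k + 1 - 1 - j = k by omega, show j + k - j = k by omega,
        show j + k + e - j = k + e by omega, gaussPoly_symm j k]
      ring
    · intro j _
      rw [gaussPoly_of_lt (by omega : t < t + 1 + j)]
      ring
  have outer : gaussPoly (L + Q + e) L = ∑ t ∈ Finset.range (L + 1),
      X ^ ((Q - t) * (L - t)) * gaussPoly Q t * gaussPoly (L + e) (L - t) := by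
    rw [← gaussPoly_vandermonde, show L + Q + e = Q + (L + e) by ring]
  rw [outer, Finset.mul_sum]
  refine Finset.sum_congr rfl fun t ht => ?_
  have ht' : t ≤ L := by simpa [Nat.lt_succ_iff] using ht
  rw [← Finset.sum_mul, inner]
  have := gaussPoly_mul_gaussPoly (P + L) (L - t) (t + e)
  rw [show P + L - (L - t) = P + t by omega, show L - t + (t + e) = L + e by omega,
    add_comm P L] at this
  rw [add_comm P L]
  linear_combination X ^ ((Q - t) * (L - t)) * gaussPoly Q t * this

/-- The Gaussian polynomial `[n + m, n]` if `n, m ≥ 0`, and `0` otherwise. -/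
noncomputable def boxPoly (n m : ℤ) : ℚ[X] :=
  if 0 ≤ n ∧ 0 ≤ m then gaussPoly (n + m).toNat n.toNat else 0

lemma boxPoly_of_neg_left {n : ℤ} (h : n < 0) (m : ℤ) : boxPoly n m = 0 :=
  if_neg fun h' => absurd h'.1 (by omega)

lemma boxPoly_of_neg_right {m : ℤ} (h : m < 0) (n : ℤ) : boxPoly n m = 0 :=
  if_neg fun h' => absurd h'.2 (by omega)

lemma boxPoly_natCast (n m : ℕ) : boxPoly n m = gaussPoly (n + m) n := by
  rw [boxPoly, if_pos ⟨by omega, by omega⟩, ← Nat.cast_add, Int.toNat_natCast, Int.toNat_natCast]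

/-- If `P = n + m` with `n ≥ 0`, then `boxPoly n m = [P, n]`, also for negative `m`. -/
lemma boxPoly_eq_gaussPoly {n m : ℤ} {P k : ℕ} (hn : n = k) (hP : n + m = P) :
    boxPoly n m = gaussPoly P k := by
  by_cases h : 0 ≤ m
  · lift m to ℕ using h
    subst hn
    rw [boxPoly_natCast]
    congr 1
    omega
  · rw [boxPoly_of_neg_right (by omega), gaussPoly_of_lt (by omega)]

lemma boxPoly_zero_left {m : ℤ} (hm : 0 ≤ m) : boxPoly 0 m = 1 := by
  lift m to ℕ using hm
  simpa using boxPoly_natCast 0 m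

lemma boxPoly_symm (n m : ℤ) : boxPoly n m = boxPoly m n := by
  by_cases hn : 0 ≤ n
  · by_cases hm : 0 ≤ m
    · lift n to ℕ using hn
      lift m to ℕ using hm
      rw [boxPoly_natCast, boxPoly_natCast, gaussPoly_symm, add_comm]
    · rw [boxPoly_of_neg_right (by omega), boxPoly_of_neg_left (by omega)]
  · rw [boxPoly_of_neg_left (by omega), boxPoly_of_neg_right (by omega)]

lemma boxPoly_zero_right {n : ℤ} (hn : 0 ≤ n) : boxPoly n 0 = 1 := by
  rw [boxPoly_symm, boxPoly_zero_left hn]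

/-- Summation over the last step of a path in the box. -/
lemma boxPoly_pascal {n m : ℤ} (h : ¬ (n = 0 ∧ m = 0)) :
    boxPoly n m = boxPoly n (m - 1) + X ^ m.toNat * boxPoly (n - 1) m := by
  rcases lt_or_ge n 0 with hn | hn
  · rw [boxPoly_of_neg_left hn, boxPoly_of_neg_left hn, boxPoly_of_neg_left (by omega)]; simp
  rcases lt_or_ge m 0 with hm | hm
  · rw [boxPoly_of_neg_right hm, boxPoly_of_neg_right hm, boxPoly_of_neg_right (by omega)]; simp
  lift n to ℕ using hn
  lift m to ℕ using hm
  rcases n with _ | n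
  · rw [boxPoly_of_neg_left (n := ((0 : ℕ) : ℤ) - 1) (by norm_num), Nat.cast_zero,
      boxPoly_zero_left (by omega), boxPoly_zero_left (by omega)]
    simp
  rcases m with _ | m
  · rw [boxPoly_of_neg_right (m := ((0 : ℕ) : ℤ) - 1) (by norm_num), Nat.cast_zero,
      boxPoly_zero_right (by omega), boxPoly_zero_right (by omega)]
    simp
  rw [show ((m + 1 : ℕ) : ℤ) - 1 = (m : ℕ) by push_cast; ring,
    show ((n + 1 : ℕ) : ℤ) - 1 = (n : ℕ) by push_cast; ring, boxPoly_natCast, boxPoly_natCast,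
    boxPoly_natCast, Int.toNat_natCast, gaussPoly_pascal]

lemma sum_boxPoly_mul_boxPoly_aux (N M u v : ℕ) :
    ∑ n ∈ Finset.range (min N M + 1), X ^ (n ^ 2) * gaussPoly (2 * M + N - n) (N - n) *
        (boxPoly (n + u) ((M : ℤ) - n - v) * boxPoly (n - u) ((M : ℤ) - n + v)) =
      X ^ (u ^ 2) * (boxPoly (N + u) (M - v - u) * boxPoly (N - u) (M + v + u)) := by
  by_cases hN : N < u
  · rw [boxPoly_of_neg_left (n := (N : ℤ) - u) (by omega), Finset.sum_eq_zero]
    · simp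
    · intro n hn
      rw [boxPoly_of_neg_left (n := (n : ℤ) - u) (by simp at hn; omega)]
      simp
  by_cases hM : M < u + v
  · rw [boxPoly_of_neg_right (m := (M : ℤ) - v - u) (by omega), Finset.sum_eq_zero]
    · simp
    · intro n hn
      by_cases hnu : n < u
      · rw [boxPoly_of_neg_left (n := (n : ℤ) - u) (by omega)]
        simp
      · rw [boxPoly_of_neg_right (m := (M : ℤ) - n - v) (by omega)]
        simp
  obtain ⟨L, rfl⟩ := Nat.exists_eq_add_of_le (not_lt.1 hN)
  obtain ⟨K, rfl⟩ := Nat.exists_eq_add_of_le (not_lt.1 hM)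
  have key := gaussPoly_saalschutz L (2 * u + K) (2 * v + K) (2 * u)
  rw [boxPoly_eq_gaussPoly (k := L + 2 * u) (P := L + (2 * u + K)) (by push_cast; ring)
      (by push_cast; ring),
    boxPoly_eq_gaussPoly (k := L) (P := L + (2 * v + K) + 2 * u) (by push_cast; ring)
      (by push_cast; ring), ← key, Finset.mul_sum]
  have hvan : ∀ n ∈ Finset.range (u + L + 1), n ∉ Finset.range (min (u + L) (u + v + K) + 1) →
      X ^ (n ^ 2) * gaussPoly (2 * (u + v + K) + (u + L) - n) (u + L - n) *
        (boxPoly (n + u) (((u + v + K : ℕ) : ℤ) - n - v) *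
          boxPoly (n - u) (((u + v + K : ℕ) : ℤ) - n + v)) = 0 := by
    intro n h1 h2
    rw [boxPoly_of_neg_right (m := (((u + v + K : ℕ) : ℤ) - n - v)) (by simp at h1 h2; omega)]
    simp
  rw [Finset.sum_subset (fun n hn => by simp at hn ⊢; omega) hvan,
    show u + L + 1 = u + (L + 1) by ring, Finset.sum_range_add, Finset.sum_eq_zero, zero_add]
  · refine Finset.sum_congr rfl fun m hm => ?_
    rw [boxPoly_eq_gaussPoly (k := m + 2 * u) (P := 2 * u + K) (by push_cast; ring)
        (by push_cast; ring),
      boxPoly_eq_gaussPoly (k := m) (P := 2 * v + K) (by push_cast; ring) (by push_cast; ring),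
      show 2 * (u + v + K) + (u + L) - (u + m) = 2 * u + K + (2 * v + K) + L - m by omega,
      show u + L - (u + m) = L - m by omega]
    ring
  · intro n hn
    rw [boxPoly_of_neg_left (n := (n : ℤ) - u) (by simp at hn; omega)]
    simp

/-- Burge's summation formula. -/
lemma sum_boxPoly_mul_boxPoly (N M : ℕ) {u v : ℤ} (h : 0 ≤ u ∧ 0 ≤ v ∨ u ≤ 0 ∧ v ≤ 0) :
    ∑ n ∈ Finset.range (min N M + 1), X ^ (n ^ 2) * gaussPoly (2 * M + N - n) (N - n) *
        (boxPoly (n + u) ((M : ℤ) - n - v) * boxPoly (n - u) ((M : ℤ) - n + v)) =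
      X ^ (u ^ 2).toNat * (boxPoly (N + u) (M - v - u) * boxPoly (N - u) (M + v + u)) := by
  rcases h with ⟨hu, hv⟩ | ⟨hu, hv⟩
  · lift u to ℕ using hu
    lift v to ℕ using hv
    have : ((u : ℤ) ^ 2).toNat = u ^ 2 := by rw [← Nat.cast_pow, Int.toNat_natCast]
    rw [this]
    exact sum_boxPoly_mul_boxPoly_aux N M u v
  · obtain ⟨u', rfl⟩ : ∃ u' : ℕ, u = -u' := ⟨u.natAbs, by omega⟩
    obtain ⟨v', rfl⟩ : ∃ v' : ℕ, v = -v' := ⟨v.natAbs, by omega⟩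
    have h1 : ((-(u' : ℤ)) ^ 2).toNat = u' ^ 2 := by
      rw [neg_sq, ← Nat.cast_pow, Int.toNat_natCast]
    have := sum_boxPoly_mul_boxPoly_aux N M u' v'
    rw [h1]
    simp only [sub_neg_eq_add, ← sub_eq_add_neg]
    rw [mul_comm (boxPoly _ _), ← this]
    exact Finset.sum_congr rfl fun n _ => by rw [mul_comm (boxPoly ((n : ℤ) - u') _)]

end Burge

namespace Burge

open Polynomial

/-! ### Recurrences for restricted partition pairs -/

lemma part_of_nonpos {N M : ℕ} (p : Fin N → Fin (M + 1)) {i : ℤ} (h : i ≤ 0) :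
    part N M p i = 0 := if_pos h

lemma part_of_gt {N M : ℕ} (p : Fin N → Fin (M + 1)) {i : ℤ} (h : (N : ℤ) < i) :
    part N M p i = M := by
  rw [part, if_neg (by omega), dif_neg (by omega)]

lemma part_succ {N M : ℕ} (p : Fin N → Fin (M + 1)) (j : Fin N) :
    part N M p ((j : ℤ) + 1) = (p j : ℕ) := by
  rw [part, if_neg (by omega), dif_pos (by simp)]
  simp

lemma part_cases {N : ℕ} (i : ℤ) : i ≤ 0 ∨ (∃ j : Fin N, i = j + 1) ∨ (N : ℤ) < i := by
  rcases le_or_gt i 0 with h | h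
  · exact Or.inl h
  rcases lt_or_ge (N : ℤ) i with h' | h'
  · exact Or.inr (Or.inr h')
  exact Or.inr (Or.inl ⟨⟨(i - 1).toNat, by omega⟩, by simp; omega⟩)

lemma part_nonneg {N M : ℕ} (p : Fin N → Fin (M + 1)) (i : ℤ) : 0 ≤ part N M p i := by
  rcases part_cases (N := N) i with h | ⟨j, rfl⟩ | h
  · rw [part_of_nonpos p h]
  · rw [part_succ]; omega
  · rw [part_of_gt p h]; omega

lemma part_le {N M : ℕ} (p : Fin N → Fin (M + 1)) (i : ℤ) : part N M p i ≤ M := by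
  rcases part_cases (N := N) i with h | ⟨j, rfl⟩ | h
  · rw [part_of_nonpos p h]; omega
  · rw [part_succ]; have := (p j).isLt; omega
  · rw [part_of_gt p h]

lemma part_castSucc {N M : ℕ} (p : Fin N → Fin (M + 1)) {i : ℤ} (h : i ≤ N) :
    part N (M + 1) (fun j => (p j).castSucc) i = part N M p i := by
  rcases part_cases (N := N) i with h' | ⟨j, rfl⟩ | h'
  · rw [part_of_nonpos _ h', part_of_nonpos _ h']
  · rw [part_succ, part_succ]; simp
  · omega

/-- The partition with one more part, equal to the maximal size. -/
def snocLast {N M : ℕ} (p : Fin N → Fin (M + 1)) : Fin (N + 1) → Fin (M + 1) :=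
  Fin.snoc (α := fun _ => Fin (M + 1)) p (Fin.last M)

@[simp] lemma snocLast_castSucc {N M : ℕ} (p : Fin N → Fin (M + 1)) (j : Fin N) :
    snocLast p j.castSucc = p j := by
  simp [snocLast]

@[simp] lemma snocLast_last {N M : ℕ} (p : Fin N → Fin (M + 1)) :
    snocLast p (Fin.last N) = Fin.last M := by
  simp [snocLast]

lemma part_snocLast {N M : ℕ} (p : Fin N → Fin (M + 1)) (i : ℤ) :
    part (N + 1) M (snocLast p) i = part N M p i := by
  rcases part_cases (N := N + 1) i with h' | ⟨j, rfl⟩ | h'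
  · rw [part_of_nonpos _ h', part_of_nonpos _ h']
  · rw [part_succ]
    induction j using Fin.lastCases with
    | last => rw [part_of_gt _ (by simp)]; simp
    | cast j => rw [snocLast_castSucc, Fin.val_castSucc, part_succ]
  · rw [part_of_gt _ h', part_of_gt _ (by push_cast at h'; omega)]

lemma monotone_snocLast {N M : ℕ} (p : Fin N → Fin (M + 1)) :
    Monotone (snocLast p) ↔ Monotone p := by
  constructor
  · intro h i j hij
    have := h (show i.castSucc ≤ j.castSucc from hij)
    simpa using this
  · intro h i j hij
    induction j using Fin.lastCases with
    | last => rw [snocLast_last]; exact Fin.le_last _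
    | cast j =>
      induction i using Fin.lastCases with
      | last => exact absurd hij (not_le.2 (Fin.castSucc_lt_last j))
      | cast i => simpa using h hij

lemma wt_snocLast {N M : ℕ} (p : Fin N → Fin (M + 1)) :
    wt (N + 1) M (snocLast p) = wt N M p + M := by
  simp [wt, Fin.sum_univ_castSucc]

lemma wt_castSucc {N M : ℕ} (p : Fin N → Fin (M + 1)) :
    wt N (M + 1) (fun j => (p j).castSucc) = wt N M p := by
  simp [wt]

lemma isRestricted_castSucc {N₁ M N₂ M₂ : ℕ} {a b α β : ℤ} (h : (N₂ : ℤ) < N₁ + a)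
    (x : Fin N₁ → Fin (M + 1)) (y : Fin N₂ → Fin (M₂ + 1)) :
    IsRestricted N₁ (M + 1) N₂ M₂ a b α β (fun j => (x j).castSucc) y ↔
      IsRestricted N₁ M N₂ M₂ a b α β x y := by
  unfold IsRestricted IsPartitionIn
  refine and_congr ⟨fun hx i j hij => ?_, fun hx i j hij => ?_⟩ (and_congr Iff.rfl
    (and_congr (forall_congr' fun i => forall_congr' fun h1 => forall_congr' fun h2 => ?_)
      (forall_congr' fun i => forall_congr' fun h1 => forall_congr' fun h2 => ?_)))
  · simpa using hx hij
  · simpa using hx hij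
  · rw [part_castSucc x (by omega)]
  · rw [part_castSucc x (by omega)]

lemma isRestricted_snocLast {N M N₂ M₂ : ℕ} {a b α β : ℤ} (h : (M₂ : ℤ) < M + β)
    (x : Fin N → Fin (M + 1)) (y : Fin N₂ → Fin (M₂ + 1)) :
    IsRestricted (N + 1) M N₂ M₂ a b α β (snocLast x) y ↔
      IsRestricted N M N₂ M₂ a b α β x y := by
  simp only [IsRestricted, IsPartitionIn, monotone_snocLast, part_snocLast]
  refine and_congr Iff.rfl (and_congr Iff.rfl (and_congr Iff.rfl
    ⟨fun H i h1 h2 => H i h1 (by push_cast; omega), fun H i h1 h2 => ?_⟩))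
  rcases lt_or_ge (N : ℤ) i with h' | h'
  · rw [part_of_gt x h']
    have := part_le y (i + 1 - b)
    omega
  · exact H i h1 h'

open Classical in
lemma sum_isRestricted_last_ne {N₁ M N₂ M₂ : ℕ} {a b α β : ℤ} (h : (N₂ : ℤ) < N₁ + a) :
    ∑ z : (Fin N₁ → Fin (M + 1 + 1)) × (Fin N₂ → Fin (M₂ + 1)) with
      IsRestricted N₁ (M + 1) N₂ M₂ a b α β z.1 z.2 ∧ ∀ i, z.1 i ≠ Fin.last (M + 1),
      (X : ℚ[X]) ^ (wt N₁ (M + 1) z.1 + wt N₂ M₂ z.2) = pairGenFun N₁ M N₂ M₂ a b α β := by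
  rw [pairGenFun]
  symm
  refine Finset.sum_nbij (fun z => (fun j => (z.1 j).castSucc, z.2)) ?_ ?_ ?_ ?_
  · intro z hz
    have hz' := (Finset.mem_filter.1 hz).2
    exact Finset.mem_filter.2 ⟨Finset.mem_univ _, (isRestricted_castSucc h _ _).2 hz',
      fun i => (Fin.castSucc_lt_last _).ne⟩
  · rintro ⟨x, y⟩ - ⟨x', y'⟩ - hxy
    simp only [Prod.mk.injEq] at hxy
    refine Prod.ext (_root_.funext fun j => ?_) hxy.2
    exact Fin.castSucc_injective _ (congrFun hxy.1 j)
  · rintro ⟨x, y⟩ hz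
    obtain ⟨-, hz1, hz2⟩ := Finset.mem_filter.1 (Finset.mem_coe.1 hz)
    have hx : (fun j => ((x j).castPred (hz2 j)).castSucc) = x := by ext; simp
    refine ⟨(fun j => (x j).castPred (hz2 j), y), ?_, Prod.ext hx rfl⟩
    refine Finset.mem_coe.2 (Finset.mem_filter.2 ⟨Finset.mem_univ _, ?_⟩)
    rw [← isRestricted_castSucc h]
    simpa only [hx] using hz1
  · intro z _
    rw [wt_castSucc]

open Classical in
lemma sum_isRestricted_last_eq {N M N₂ M₂ : ℕ} {a b α β : ℤ} (h : (M₂ : ℤ) < M + β) :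
    ∑ z : (Fin (N + 1) → Fin (M + 1)) × (Fin N₂ → Fin (M₂ + 1)) with
      IsRestricted (N + 1) M N₂ M₂ a b α β z.1 z.2 ∧ z.1 (Fin.last N) = Fin.last M,
      (X : ℚ[X]) ^ (wt (N + 1) M z.1 + wt N₂ M₂ z.2) =
        X ^ M * pairGenFun N M N₂ M₂ a b α β := by
  rw [pairGenFun, Finset.mul_sum]
  symm
  refine Finset.sum_nbij (fun z => (snocLast z.1, z.2)) ?_ ?_ ?_ ?_
  · intro z hz
    have hz' := (Finset.mem_filter.1 hz).2
    exact Finset.mem_filter.2 ⟨Finset.mem_univ _, (isRestricted_snocLast h _ _).2 hz',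
      snocLast_last _⟩
  · rintro ⟨x, y⟩ - ⟨x', y'⟩ - hxy
    simp only [Prod.mk.injEq] at hxy
    refine Prod.ext (_root_.funext fun j => ?_) hxy.2
    simpa using congrFun hxy.1 j.castSucc
  · rintro ⟨x, y⟩ hz
    obtain ⟨-, hz1, hz2⟩ := Finset.mem_filter.1 (Finset.mem_coe.1 hz)
    have hx : snocLast (fun j => x j.castSucc) = x := by
      funext j
      induction j using Fin.lastCases with
      | last => rw [snocLast_last, ← hz2]
      | cast j => rw [snocLast_castSucc]
    refine ⟨(fun j => x j.castSucc, y), ?_, Prod.ext hx rfl⟩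
    refine Finset.mem_coe.2 (Finset.mem_filter.2 ⟨Finset.mem_univ _, ?_⟩)
    rw [← isRestricted_snocLast h]
    simpa only [hx] using hz1
  · intro z _
    rw [wt_snocLast]
    ring

lemma pairGenFun_succ_succ {N M N₂ M₂ : ℕ} {a b α β : ℤ} (hN : (N₂ : ℤ) < N + 1 + a)
    (hM : (M₂ : ℤ) < M + 1 + β) :
    pairGenFun (N + 1) (M + 1) N₂ M₂ a b α β =
      pairGenFun (N + 1) M N₂ M₂ a b α β + X ^ (M + 1) * pairGenFun N (M + 1) N₂ M₂ a b α β := by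
  classical
  rw [← sum_isRestricted_last_eq (N := N) (M := M + 1) (by push_cast; exact hM),
    ← sum_isRestricted_last_ne (N₁ := N + 1) (M := M) (by push_cast; exact hN)]
  conv_lhs => rw [pairGenFun]
  rw [← Finset.sum_filter_add_sum_filter_not _
      (fun z : (Fin (N + 1) → Fin (M + 1 + 1)) × (Fin N₂ → Fin (M₂ + 1)) =>
        ∀ i, z.1 i ≠ Fin.last (M + 1)), Finset.filter_filter, Finset.filter_filter]
  congr 1
  · refine Finset.sum_congr (Finset.filter_congr fun z _ => and_congr_right fun hz => ?_)
      fun _ _ => rfl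
    push Not
    refine ⟨fun ⟨i, hi⟩ => le_antisymm (Fin.le_last _) ?_, fun h => ⟨_, h⟩⟩
    rw [← hi]
    exact hz.1 (Fin.le_last i)

lemma pairGenFun_zero_succ {M N₂ M₂ : ℕ} {a b α β : ℤ} (hN : (N₂ : ℤ) < a) :
    pairGenFun 0 (M + 1) N₂ M₂ a b α β = pairGenFun 0 M N₂ M₂ a b α β := by
  classical
  rw [← sum_isRestricted_last_ne (N₁ := 0) (M := M) (by simpa using hN)]
  conv_lhs => rw [pairGenFun]
  refine Finset.sum_congr (Finset.filter_congr fun z _ => ?_) fun _ _ => rfl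
  exact ⟨fun h => ⟨h, fun i => i.elim0⟩, fun h => h.1⟩

lemma pairGenFun_succ_zero {N N₂ M₂ : ℕ} {a b α β : ℤ} (hM : (M₂ : ℤ) < β) :
    pairGenFun (N + 1) 0 N₂ M₂ a b α β = pairGenFun N 0 N₂ M₂ a b α β := by
  classical
  have := sum_isRestricted_last_eq (N := N) (M := 0) (N₂ := N₂) (M₂ := M₂) (a := a) (b := b)
    (α := α) (β := β) (by simpa using hM)
  rw [pow_zero, one_mul] at this
  rw [← this, pairGenFun]
  refine Finset.sum_congr (Finset.filter_congr fun z _ => ?_) fun _ _ => rfl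
  exact ⟨fun h => ⟨h, Subsingleton.elim (α := Fin 1) _ _⟩, fun h => h.1⟩

lemma pairGenFun_swap (N₁ M₁ N₂ M₂ : ℕ) (a b α β : ℤ) :
    pairGenFun N₁ M₁ N₂ M₂ a b α β = pairGenFun N₂ M₂ N₁ M₁ b a β α := by
  classical
  rw [pairGenFun, pairGenFun]
  refine Finset.sum_equiv (Equiv.prodComm _ _) (fun z => ?_) fun z _ => ?_
  · rw [Finset.mem_filter, Finset.mem_filter]
    simp only [Finset.mem_univ, true_and, IsRestricted, Equiv.prodComm_apply,
      Prod.fst_swap, Prod.snd_swap]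
    tauto
  · simp [add_comm]

lemma pairGenFun_eq_zero {N₁ M₁ N₂ M₂ : ℕ} {a b α β : ℤ} (hN : (N₁ : ℤ) = N₂ + b)
    (hM : (M₁ : ℤ) = M₂ - β) : pairGenFun N₁ M₁ N₂ M₂ a b α β = 0 := by
  classical
  rw [pairGenFun, Finset.sum_eq_zero]
  intro z hz
  have h := (Finset.mem_filter.1 hz).2.2.2.2 N₁ (by omega) le_rfl
  rw [part_of_gt z.2 (by omega)] at h
  have := part_le z.1 N₁
  omega

lemma wt_eq_zero {N M : ℕ} (h : N = 0 ∨ M = 0) (p : Fin N → Fin (M + 1)) : wt N M p = 0 := by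
  rw [wt, Finset.sum_eq_zero]
  intro i _
  rcases h with rfl | rfl
  · exact i.elim0
  · have := (p i).isLt
    omega

lemma pairGenFun_eq_one {N₂ M₂ : ℕ} {a b α β : ℤ} (hN : (N₂ : ℤ) < a)
    (hM : (M₂ : ℤ) < β) (h : N₂ = 0 ∨ M₂ = 0) : pairGenFun 0 0 N₂ M₂ a b α β = 1 := by
  classical
  have hsub : ∀ y y' : Fin N₂ → Fin (M₂ + 1), y = y' := by
    intro y y'
    rcases h with rfl | rfl
    · exact Subsingleton.elim _ _
    · exact _root_.funext fun i => Subsingleton.elim (α := Fin 1) _ _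
  rw [pairGenFun, Finset.sum_eq_single_of_mem ((fun _ => 0), fun _ => 0)]
  · rw [wt_eq_zero (Or.inl rfl), wt_eq_zero h]; simp
  · refine Finset.mem_filter.2 ⟨Finset.mem_univ _, fun i => i.elim0, fun _ _ _ => le_rfl,
      fun i h1 h2 => by omega, fun i h1 h2 => ?_⟩
    have h1 := part_le (N := N₂) (M := M₂) (fun _ => 0) (i + 1 - b)
    have h2 := part_nonneg (N := 0) (M := 0) (fun _ => 0) i
    dsimp only at h1 h2 ⊢
    omega
  · rintro ⟨x, y⟩ - hne
    exact absurd (Prod.ext (_root_.funext fun i => Fin.elim0 i) (hsub _ _)) hne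

end Burge

namespace Burge

open Polynomial

/-! ### The alternating sum for the generating function of restricted partition pairs -/

/-- The generating function of paths in a box, as a rational function. -/
noncomputable def boxRat (n m : ℤ) : RatFunc ℚ := algebraMap ℚ[X] (RatFunc ℚ) (boxPoly n m)

lemma boxRat_pascal {n m : ℤ} (h : ¬ (n = 0 ∧ m = 0)) :
    boxRat n m = boxRat n (m - 1) + RatFunc.X ^ m * boxRat (n - 1) m := by
  rw [boxRat, boxPoly_pascal h, map_add, map_mul, map_pow, RatFunc.algebraMap_X, boxRat, boxRat]
  rcases lt_or_ge m 0 with hm | hm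
  · rw [boxPoly_of_neg_right hm]; simp
  · lift m to ℕ using hm
    simp

lemma boxRat_of_neg_left {n : ℤ} (h : n < 0) (m : ℤ) : boxRat n m = 0 := by
  rw [boxRat, boxPoly_of_neg_left h, map_zero]

lemma boxRat_of_neg_right {m : ℤ} (h : m < 0) (n : ℤ) : boxRat n m = 0 := by
  rw [boxRat, boxPoly_of_neg_right h, map_zero]

lemma boxRat_symm (n m : ℤ) : boxRat n m = boxRat m n := by
  rw [boxRat, boxPoly_symm, boxRat]

/-- The terms of the alternating sum that come from translations. -/
noncomputable def transTerm (a b α β n₁ m₁ n₂ m₂ k : ℤ) : RatFunc ℚ :=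
  RatFunc.X ^ (k ^ 2 * ((a + b) * (α + β)) + k * (a * β - b * α) + k * (α + β) * (n₁ - n₂)) *
    (boxRat (n₁ + k * (a + b)) (m₁ - k * (α + β)) * boxRat (n₂ - k * (a + b)) (m₂ + k * (α + β)))

/-- The terms of the alternating sum that come from reflections. -/
noncomputable def reflTerm (a b α β n₁ m₁ n₂ m₂ k : ℤ) : RatFunc ℚ :=
  RatFunc.X ^ ((k * (α + β) + β) * (k * (a + b) + b + n₂ - n₁)) *
    (boxRat (n₂ + b + k * (a + b)) (m₂ - β - k * (α + β)) *
      boxRat (n₁ - b - k * (a + b)) (m₁ + β + k * (α + β)))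

/-- The alternating sum. -/
noncomputable def altSum (a b α β n₁ m₁ n₂ m₂ : ℤ) : RatFunc ℚ :=
  ∑ᶠ k, transTerm a b α β n₁ m₁ n₂ m₂ k - ∑ᶠ k, reflTerm a b α β n₁ m₁ n₂ m₂ k

lemma mem_Icc_of_mul_le {A x y k : ℤ} (hA : 0 < A) (h1 : 0 ≤ x + k * A) (h2 : 0 ≤ y - k * A) :
    k ∈ Set.Icc (-|x|) |y| := by
  have hx := le_abs_self x
  have hy := le_abs_self y
  have hx' := abs_nonneg x
  have hy' := abs_nonneg y
  constructor
  · by_contra! h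
    nlinarith
  · by_contra! h
    nlinarith

lemma boxRat_mul_boxRat_ne_zero {n m n' m' : ℤ} (h : boxRat n m * boxRat n' m' ≠ 0) :
    (0 ≤ n ∧ 0 ≤ m) ∧ 0 ≤ n' ∧ 0 ≤ m' := by
  refine ⟨⟨?_, ?_⟩, ?_, ?_⟩ <;> by_contra! hn <;> refine h ?_
  · rw [boxRat_of_neg_left hn, zero_mul]
  · rw [boxRat_of_neg_right hn, zero_mul]
  · rw [boxRat_of_neg_left hn, mul_zero]
  · rw [boxRat_of_neg_right hn, mul_zero]

section

variable {a b α β : ℤ} (n₁ m₁ n₂ m₂ : ℤ)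

lemma finite_support_transTerm (hA : 0 < a + b) :
    (Function.support (transTerm a b α β n₁ m₁ n₂ m₂)).Finite := by
  refine (Set.finite_Icc (-|n₁|) |n₂|).subset fun k hk => ?_
  obtain ⟨⟨h1, -⟩, h2, -⟩ := boxRat_mul_boxRat_ne_zero (right_ne_zero_of_mul hk)
  exact mem_Icc_of_mul_le hA h1 h2

lemma finite_support_reflTerm (hA : 0 < a + b) :
    (Function.support (reflTerm a b α β n₁ m₁ n₂ m₂)).Finite := by
  refine (Set.finite_Icc (-|n₂ + b|) |n₁ - b|).subset fun k hk => ?_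
  obtain ⟨⟨h1, -⟩, h2, -⟩ := boxRat_mul_boxRat_ne_zero (right_ne_zero_of_mul hk)
  exact mem_Icc_of_mul_le hA h1 h2

lemma transTerm_pascal {k : ℤ} (h : ¬ (n₁ + k * (a + b) = 0 ∧ m₁ - k * (α + β) = 0)) :
    transTerm a b α β n₁ m₁ n₂ m₂ k = transTerm a b α β n₁ (m₁ - 1) n₂ m₂ k +
      RatFunc.X ^ m₁ * transTerm a b α β (n₁ - 1) m₁ n₂ m₂ k := by
  have hX : (RatFunc.X : RatFunc ℚ) ≠ 0 := RatFunc.X_ne_zero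
  have e : (RatFunc.X : RatFunc ℚ) ^ (k ^ 2 * ((a + b) * (α + β)) + k * (a * β - b * α) +
      k * (α + β) * (n₁ - n₂)) * RatFunc.X ^ (m₁ - k * (α + β)) = RatFunc.X ^ m₁ * RatFunc.X ^
      (k ^ 2 * ((a + b) * (α + β)) + k * (a * β - b * α) + k * (α + β) * (n₁ - 1 - n₂)) := by
    rw [← zpow_add₀ hX, ← zpow_add₀ hX]
    congr 1
    ring
  rw [transTerm, boxRat_pascal h, transTerm, transTerm,
    show m₁ - k * (α + β) - 1 = m₁ - 1 - k * (α + β) by ring,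
    show n₁ + k * (a + b) - 1 = n₁ - 1 + k * (a + b) by ring]
  linear_combination boxRat (n₁ - 1 + k * (a + b)) (m₁ - k * (α + β)) *
    boxRat (n₂ - k * (a + b)) (m₂ + k * (α + β)) * e

lemma reflTerm_pascal {k : ℤ} (h : ¬ (n₁ - b - k * (a + b) = 0 ∧ m₁ + β + k * (α + β) = 0)) :
    reflTerm a b α β n₁ m₁ n₂ m₂ k = reflTerm a b α β n₁ (m₁ - 1) n₂ m₂ k +
      RatFunc.X ^ m₁ * reflTerm a b α β (n₁ - 1) m₁ n₂ m₂ k := by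
  have hX : (RatFunc.X : RatFunc ℚ) ≠ 0 := RatFunc.X_ne_zero
  have e : (RatFunc.X : RatFunc ℚ) ^ ((k * (α + β) + β) * (k * (a + b) + b + n₂ - n₁)) *
      RatFunc.X ^ (m₁ + β + k * (α + β)) = RatFunc.X ^ m₁ * RatFunc.X ^
      ((k * (α + β) + β) * (k * (a + b) + b + n₂ - (n₁ - 1))) := by
    rw [← zpow_add₀ hX, ← zpow_add₀ hX]
    congr 1
    ring
  rw [reflTerm, boxRat_pascal h, reflTerm, reflTerm,
    show m₁ + β + k * (α + β) - 1 = m₁ - 1 + β + k * (α + β) by ring,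
    show n₁ - b - k * (a + b) - 1 = n₁ - 1 - b - k * (a + b) by ring]
  linear_combination boxRat (n₂ + b + k * (a + b)) (m₂ - β - k * (α + β)) *
    boxRat (n₁ - 1 - b - k * (a + b)) (m₁ + β + k * (α + β)) * e

lemma altSum_swap : altSum a b α β n₁ m₁ n₂ m₂ = altSum b a β α n₂ m₂ n₁ m₁ := by
  rw [altSum, altSum, ← finsum_comp_equiv (Equiv.neg ℤ) (f := transTerm b a β α n₂ m₂ n₁ m₁),
    ← finsum_comp_equiv (Equiv.subLeft (-1 : ℤ)) (f := reflTerm b a β α n₂ m₂ n₁ m₁)]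
  congr 1
  · refine finsum_congr fun k => ?_
    rw [Equiv.neg_apply, transTerm, transTerm, mul_comm (boxRat _ _)]
    congr 1
    · congr 1; ring
    · congr 2 <;> ring
  · refine finsum_congr fun k => ?_
    rw [Equiv.subLeft_apply, reflTerm, reflTerm, mul_comm (boxRat _ _)]
    congr 1
    · congr 1; ring
    · congr 2 <;> ring

lemma altSum_conj (n m : ℤ) : altSum a b α β n m n m = altSum α β a b m n m n := by
  rw [altSum, altSum, ← finsum_comp_equiv (Equiv.neg ℤ) (f := transTerm α β a b m n m n)]
  congr 1
  · refine finsum_congr fun k => ?_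
    rw [Equiv.neg_apply, transTerm, transTerm, boxRat_symm (n + _), boxRat_symm (n - _)]
    congr 1
    · congr 1; ring
    · congr 2 <;> ring
  · refine finsum_congr fun k => ?_
    rw [reflTerm, reflTerm, mul_comm (boxRat (n + _ + _) _), boxRat_symm (n + _ + _),
      boxRat_symm (n - _ - _)]
    congr 1
    · congr 1; ring

lemma altSum_eq_zero (hn : n₁ = n₂ + b) (hm : m₁ = m₂ - β) :
    altSum a b α β n₁ m₁ n₂ m₂ = 0 := by
  subst hn hm
  rw [altSum, sub_eq_zero]
  refine finsum_congr fun k => ?_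
  rw [transTerm, reflTerm]
  congr 1
  · congr 1; ring
  · congr 2 <;> ring

lemma altSum_pascal (ha : 0 ≤ a) (hb : 0 ≤ b) (hα : 0 ≤ α) (hβ : 0 ≤ β) (hA : 0 < a + b)
    (hn₁ : 0 ≤ n₁) (hm₁ : 0 ≤ m₁) (hn₂ : 0 ≤ n₂) (hm₂ : 0 ≤ m₂)
    (h0 : ¬ (n₁ = 0 ∧ m₁ = 0)) (hn : n₂ < n₁ + a) (hm : m₂ < m₁ + β) :
    altSum a b α β n₁ m₁ n₂ m₂ = altSum a b α β n₁ (m₁ - 1) n₂ m₂ +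
      RatFunc.X ^ m₁ * altSum a b α β (n₁ - 1) m₁ n₂ m₂ := by
  have e1 : ∀ k, transTerm a b α β n₁ m₁ n₂ m₂ k = transTerm a b α β n₁ (m₁ - 1) n₂ m₂ k +
      RatFunc.X ^ m₁ * transTerm a b α β (n₁ - 1) m₁ n₂ m₂ k := by
    intro k
    refine transTerm_pascal _ _ _ _ fun ⟨h1, h2⟩ => ?_
    rcases lt_trichotomy k 0 with hk | rfl | hk
    · nlinarith
    · exact h0 ⟨by linarith, by linarith⟩
    · nlinarith
  have e2 : ∀ k, reflTerm a b α β n₁ m₁ n₂ m₂ k = reflTerm a b α β n₁ (m₁ - 1) n₂ m₂ k +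
      RatFunc.X ^ m₁ * reflTerm a b α β (n₁ - 1) m₁ n₂ m₂ k := by
    intro k
    refine reflTerm_pascal _ _ _ _ fun ⟨h1, h2⟩ => ?_
    rcases lt_or_ge k 0 with hk | hk
    · nlinarith
    · nlinarith
  have f1 := fun n m => finite_support_transTerm (a := a) (b := b) (α := α) (β := β) n m n₂ m₂ hA
  have f2 := fun n m => finite_support_reflTerm (a := a) (b := b) (α := α) (β := β) n m n₂ m₂ hA
  rw [altSum, altSum, altSum, finsum_congr e1, finsum_congr e2,
    finsum_add_distrib (f1 _ _) ((f1 (n₁ - 1) m₁).subset fun k hk =>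
      right_ne_zero_of_mul hk),
    finsum_add_distrib (f2 _ _) ((f2 (n₁ - 1) m₁).subset fun k hk =>
      right_ne_zero_of_mul hk),
    ← mul_finsum, ← mul_finsum]
  ring

lemma altSum_of_left_eq_neg_one (ha : 0 ≤ a) (hb : 0 ≤ b) (hn : n₂ < a) :
    altSum a b α β (-1) m₁ n₂ m₂ = 0 := by
  have e1 : ∀ k, transTerm a b α β (-1) m₁ n₂ m₂ k = 0 := by
    intro k
    by_contra hk
    obtain ⟨⟨h1, -⟩, h2, -⟩ := boxRat_mul_boxRat_ne_zero (right_ne_zero_of_mul hk)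
    rcases le_or_gt k 0 with h | h <;> nlinarith
  have e2 : ∀ k, reflTerm a b α β (-1) m₁ n₂ m₂ k = 0 := by
    intro k
    by_contra hk
    obtain ⟨⟨h1, -⟩, h2, -⟩ := boxRat_mul_boxRat_ne_zero (right_ne_zero_of_mul hk)
    rcases lt_or_ge k 0 with h | h <;> nlinarith
  rw [altSum, finsum_congr e1, finsum_congr e2, finsum_zero, sub_zero]

lemma altSum_of_right_eq_neg_one (hα : 0 ≤ α) (hβ : 0 ≤ β) (hm : m₂ < β) :
    altSum a b α β n₁ (-1) n₂ m₂ = 0 := by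
  have e1 : ∀ k, transTerm a b α β n₁ (-1) n₂ m₂ k = 0 := by
    intro k
    by_contra hk
    obtain ⟨⟨-, h1⟩, -, h2⟩ := boxRat_mul_boxRat_ne_zero (right_ne_zero_of_mul hk)
    rcases lt_or_ge k 0 with h | h <;> nlinarith
  have e2 : ∀ k, reflTerm a b α β n₁ (-1) n₂ m₂ k = 0 := by
    intro k
    by_contra hk
    obtain ⟨⟨-, h1⟩, -, h2⟩ := boxRat_mul_boxRat_ne_zero (right_ne_zero_of_mul hk)
    rcases lt_or_ge k 0 with h | h <;> nlinarith
  rw [altSum, finsum_congr e1, finsum_congr e2, finsum_zero, sub_zero]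

lemma altSum_eq_one (ha : 0 ≤ a) (hb : 0 ≤ b) (hα : 0 ≤ α) (hβ : 0 ≤ β) (hA : 0 < a + b)
    (hB : 0 < α + β) (hn₂ : 0 ≤ n₂) (hm₂ : 0 ≤ m₂) (hn : n₂ < a) (hm : m₂ < β)
    (h : n₂ = 0 ∨ m₂ = 0) : altSum a b α β 0 0 n₂ m₂ = 1 := by
  have e1 : ∀ k, k ≠ 0 → transTerm a b α β 0 0 n₂ m₂ k = 0 := by
    intro k hk0
    by_contra hk
    obtain ⟨⟨h1, h2⟩, -⟩ := boxRat_mul_boxRat_ne_zero (right_ne_zero_of_mul hk)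
    rcases lt_or_gt_of_ne hk0 with h | h <;> nlinarith
  have e2 : ∀ k, reflTerm a b α β 0 0 n₂ m₂ k = 0 := by
    intro k
    by_contra hk
    obtain ⟨⟨h1, h2⟩, h3, h4⟩ := boxRat_mul_boxRat_ne_zero (right_ne_zero_of_mul hk)
    rcases lt_or_ge k 0 with h | h <;> nlinarith
  rw [altSum, finsum_eq_single _ 0 e1, finsum_congr e2, finsum_zero, sub_zero, transTerm]
  rcases h with rfl | rfl
  · simp [boxRat, boxPoly_zero_left, hm₂]
  · simp [boxRat, boxPoly_zero_right, hn₂]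

end

/-- One step of the induction: the last step of the first path is removed. -/
lemma pairGenFun_eq_altSum_step {a b α β : ℤ} (ha : 0 ≤ a) (hb : 0 ≤ b) (hα : 0 ≤ α) (hβ : 0 ≤ β)
    (hA : 0 < a + b) {N₁ M₁ N₂ M₂ : ℕ} (h0 : ¬ (N₁ = 0 ∧ M₁ = 0))
    (hn : (N₂ : ℤ) < N₁ + a) (hm : (M₂ : ℤ) < M₁ + β)
    (ihM : ∀ M, M₁ = M + 1 → algebraMap ℚ[X] (RatFunc ℚ) (pairGenFun N₁ M N₂ M₂ a b α β) =
      altSum a b α β N₁ M N₂ M₂)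
    (ihN : ∀ N, N₁ = N + 1 → algebraMap ℚ[X] (RatFunc ℚ) (pairGenFun N M₁ N₂ M₂ a b α β) =
      altSum a b α β N M₁ N₂ M₂) :
    algebraMap ℚ[X] (RatFunc ℚ) (pairGenFun N₁ M₁ N₂ M₂ a b α β) =
      altSum a b α β N₁ M₁ N₂ M₂ := by
  rw [altSum_pascal (a := a) (b := b) (α := α) (β := β) N₁ M₁ N₂ M₂ ha hb hα hβ hA (by omega)
    (by omega) (by omega) (by omega) (by omega) hn hm]
  rcases N₁ with _ | N <;> rcases M₁ with _ | M
  · exact absurd ⟨rfl, rfl⟩ h0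
  · have hn' : (N₂ : ℤ) < a := by simpa using hn
    rw [pairGenFun_zero_succ hn', ihM M rfl, Nat.cast_zero, zero_sub,
      altSum_of_left_eq_neg_one _ _ _ ha hb hn']
    simp
  · have hm' : (M₂ : ℤ) < β := by simpa using hm
    rw [pairGenFun_succ_zero hm', ihN N rfl, Nat.cast_zero, zero_sub,
      altSum_of_right_eq_neg_one _ _ _ hα hβ hm']
    simp
  · rw [pairGenFun_succ_succ (by push_cast at hn; exact hn) (by push_cast at hm; exact hm), map_add,
      map_mul, ihM M rfl, ihN N rfl, map_pow, RatFunc.algebraMap_X, ← zpow_natCast]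
    push_cast
    simp

/-- The generating function of restricted partition pairs is an alternating sum. -/
theorem pairGenFun_eq_altSum {a b α β : ℤ} (ha : 0 ≤ a) (hb : 0 ≤ b) (hα : 0 ≤ α) (hβ : 0 ≤ β)
    (hA : 0 < a + b) (hB : 0 < α + β) (N₁ M₁ N₂ M₂ : ℕ) (h1 : (N₂ : ℤ) ≤ N₁ + a)
    (h2 : (N₁ : ℤ) ≤ N₂ + b) (h3 : (M₂ : ℤ) ≤ M₁ + β) (h4 : (M₁ : ℤ) ≤ M₂ + α) :
    algebraMap ℚ[X] (RatFunc ℚ) (pairGenFun N₁ M₁ N₂ M₂ a b α β) =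
      altSum a b α β N₁ M₁ N₂ M₂ := by
  induction hs : N₁ + M₁ + N₂ + M₂ using Nat.strong_induction_on generalizing N₁ M₁ N₂ M₂ with
  | _ s ih =>
  by_cases c1 : (N₂ : ℤ) < N₁ + a ∧ (M₂ : ℤ) < M₁ + β ∧ ¬ (N₁ = 0 ∧ M₁ = 0)
  · refine pairGenFun_eq_altSum_step ha hb hα hβ hA c1.2.2 c1.1 c1.2.1 ?_ ?_
    · rintro M rfl
      exact ih _ (by omega) _ _ _ _ h1 h2 (by omega) (by omega) rfl
    · rintro N rfl
      exact ih _ (by omega) _ _ _ _ (by omega) (by omega) h3 h4 rfl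
  by_cases c2 : (N₁ : ℤ) < N₂ + b ∧ (M₁ : ℤ) < M₂ + α ∧ ¬ (N₂ = 0 ∧ M₂ = 0)
  · rw [pairGenFun_swap, altSum_swap]
    refine pairGenFun_eq_altSum_step hb ha hβ hα (by omega) c2.2.2 c2.1 c2.2.1 ?_ ?_
    · rintro M rfl
      rw [pairGenFun_swap, altSum_swap]
      exact ih _ (by omega) _ _ _ _ h1 h2 (by omega) (by omega) rfl
    · rintro N rfl
      rw [pairGenFun_swap, altSum_swap]
      exact ih _ (by omega) _ _ _ _ (by omega) (by omega) h3 h4 rfl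
  by_cases c3 : (N₁ : ℤ) = N₂ + b ∧ (M₁ : ℤ) = M₂ - β
  · rw [pairGenFun_eq_zero c3.1 c3.2, altSum_eq_zero _ _ _ _ c3.1 c3.2, map_zero]
  by_cases c4 : (N₂ : ℤ) = N₁ + a ∧ (M₂ : ℤ) = M₁ - α
  · rw [pairGenFun_swap, altSum_swap, pairGenFun_eq_zero c4.1 c4.2,
      altSum_eq_zero _ _ _ _ c4.1 c4.2, map_zero]
  by_cases c5 : N₁ = 0 ∧ M₁ = 0 ∧ (N₂ : ℤ) < a ∧ (M₂ : ℤ) < β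
  · obtain ⟨rfl, rfl, c5, c6⟩ := c5
    have h : N₂ = 0 ∨ M₂ = 0 := by omega
    rw [pairGenFun_eq_one c5 c6 h, Nat.cast_zero, altSum_eq_one _ _ ha hb hα hβ hA hB (by omega)
      (by omega) c5 c6 (by omega), map_one]
  · have c6 : N₂ = 0 ∧ M₂ = 0 ∧ (N₁ : ℤ) < b ∧ (M₁ : ℤ) < α := by omega
    obtain ⟨rfl, rfl, c6, c7⟩ := c6
    have h : N₁ = 0 ∨ M₁ = 0 := by omega
    rw [pairGenFun_swap, altSum_swap, pairGenFun_eq_one c6 c7 h, Nat.cast_zero,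
      altSum_eq_one _ _ hb ha hβ hα (by omega) (by omega) (by omega)
      (by omega) c6 c7 (by omega), map_one]

end Burge

namespace Burge

open Polynomial

/-! ### The Burge transform -/

section

variable {a b α β : ℤ} (N M : ℕ)

lemma algebraMap_R (ha : 0 ≤ a) (hb : 0 ≤ b) (hα : 0 ≤ α) (hβ : 0 ≤ β)
    (hA : 0 < a + b) (hB : 0 < α + β) :
    algebraMap ℚ[X] (RatFunc ℚ) (R N M a b α β) = altSum a b α β N M N M :=
  pairGenFun_eq_altSum ha hb hα hβ hA hB N M N M (by omega) (by omega) (by omega) (by omega)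

/-- Conjugation of both partitions. -/
lemma R_conj (ha : 0 ≤ a) (hb : 0 ≤ b) (hα : 0 ≤ α) (hβ : 0 ≤ β)
    (hA : 0 < a + b) (hB : 0 < α + β) : R N M a b α β = R M N α β a b := by
  apply RatFunc.algebraMap_injective ℚ
  rw [algebraMap_R N M ha hb hα hβ hA hB, algebraMap_R M N hα hβ ha hb hB hA, altSum_conj]

lemma sum_boxRat_mul_boxRat {u v : ℤ} (e : ℤ) (h : 0 ≤ u ∧ 0 ≤ v ∨ u ≤ 0 ∧ v ≤ 0) :
    ∑ n ∈ Finset.range (min N M + 1),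
        algebraMap ℚ[X] (RatFunc ℚ) (X ^ (n ^ 2) * gaussPoly (2 * M + N - n) (N - n)) *
        (RatFunc.X ^ e * (boxRat (n + u) ((M - n : ℕ) - v) * boxRat (n - u) ((M - n : ℕ) + v))) =
      RatFunc.X ^ (e + u ^ 2) * (boxRat (N + u) (M - v - u) * boxRat (N - u) (M + v + u)) := by
  have h1 := congrArg (algebraMap ℚ[X] (RatFunc ℚ)) (sum_boxPoly_mul_boxPoly N M h)
  rw [map_sum, map_mul, map_mul, map_pow, RatFunc.algebraMap_X, ← zpow_natCast,
    Int.toNat_of_nonneg (sq_nonneg u)] at h1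
  simp only [mul_left_comm _ (RatFunc.X ^ e)]
  rw [zpow_add₀ RatFunc.X_ne_zero, mul_assoc, boxRat, boxRat, ← h1, ← Finset.mul_sum]
  congr 1
  refine Finset.sum_congr rfl fun n hn => ?_
  rw [map_mul _ (_ * _) (_ * _), map_mul _ (boxPoly _ _),
    Nat.cast_sub (by simp at hn; omega)]
  rfl

lemma transTerm_diag (n m k : ℤ) : transTerm a b α β n m n m k =
    RatFunc.X ^ (k ^ 2 * ((a + b) * (α + β)) + k * (a * β - b * α)) *
      (boxRat (n + k * (a + b)) (m - k * (α + β)) *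
        boxRat (n - k * (a + b)) (m + k * (α + β))) := by
  rw [transTerm, sub_self, mul_zero, add_zero]

lemma reflTerm_diag (n m k : ℤ) : reflTerm a b α β n m n m k =
    RatFunc.X ^ ((k * (a + b) + b) * (k * (α + β) + β)) *
      (boxRat (n + (k * (a + b) + b)) (m - (k * (α + β) + β)) *
        boxRat (n - (k * (a + b) + b)) (m + (k * (α + β) + β))) := by
  rw [reflTerm]
  congr 1
  · congr 1; ring
  · congr 2 <;> ring

lemma R_transform (ha : 0 ≤ a) (hb : 0 ≤ b) (hα : 0 ≤ α) (hβ : 0 ≤ β)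
    (hA : 0 < a + b) (hB : 0 < α + β) :
    R N M a b (α + a) (β + b) = ∑ n ∈ Finset.range (min N M + 1),
      X ^ (n ^ 2) * gaussPoly (2 * M + N - n) (N - n) * R n (M - n) a b α β := by
  apply RatFunc.algebraMap_injective ℚ
  rw [algebraMap_R N M ha hb (by omega) (by omega) hA (by omega), map_sum]
  simp only [map_mul (algebraMap ℚ[X] (RatFunc ℚ)) (_ * _) (R _ _ _ _ _ _),
    algebraMap_R _ _ ha hb hα hβ hA hB]
  simp only [altSum, mul_sub, Finset.sum_sub_distrib, mul_finsum]
  rw [← finsum_sum_comm, ← finsum_sum_comm]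
  · congr 1
    · refine finsum_congr fun k => ?_
      simp only [transTerm_diag]
      rw [sum_boxRat_mul_boxRat N M]
      · congr 1
        · congr 1; ring
        · congr 2 <;> ring
      · rcases le_total 0 k with h | h
        · exact Or.inl ⟨by positivity, by positivity⟩
        · exact Or.inr ⟨mul_nonpos_of_nonpos_of_nonneg h hA.le,
            mul_nonpos_of_nonpos_of_nonneg h hB.le⟩
    · refine finsum_congr fun k => ?_
      simp only [reflTerm_diag]
      rw [sum_boxRat_mul_boxRat N M]
      · congr 1
        · congr 1; ring
        · congr 2 <;> ring
      · rcases le_or_gt 0 k with h | h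
        · exact Or.inl ⟨by positivity, by positivity⟩
        · exact Or.inr ⟨by nlinarith, by nlinarith⟩
  · intro n _
    exact (finite_support_reflTerm _ _ _ _ hA).subset fun k hk => right_ne_zero_of_mul hk
  · intro n _
    exact (finite_support_transTerm _ _ _ _ hA).subset fun k hk => right_ne_zero_of_mul hk

end

lemma R_zero_one_one_one (N M : ℕ) : R N M 0 1 1 1 = if M = 0 then 1 else 0 := by
  classical
  rw [R, pairGenFun]
  split_ifs with h
  · subst h
    rw [Finset.sum_eq_single_of_mem ((fun _ => 0), fun _ => 0)]
    · rw [wt_eq_zero (Or.inr rfl)]; simp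
    · refine Finset.mem_filter.2 ⟨Finset.mem_univ _, fun _ _ _ => le_rfl, fun _ _ _ => le_rfl,
        fun i _ _ => ?_, fun i _ _ => ?_⟩
      · have h1 := part_le (N := N) (M := 0) (fun _ => 0) (i + 1 - 0)
        have h2 := part_nonneg (N := N) (M := 0) (fun _ => 0) i
        push_cast at h1
        dsimp only
        linarith
      · have h1 := part_le (N := N) (M := 0) (fun _ => 0) (i + 1 - 1)
        have h2 := part_nonneg (N := N) (M := 0) (fun _ => 0) i
        push_cast at h1
        dsimp only
        linarith
    · rintro z - hz
      exact absurd (Prod.ext (_root_.funext fun i => Subsingleton.elim (α := Fin 1) _ _)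
        (_root_.funext fun i => Subsingleton.elim (α := Fin 1) _ _)) hz
  · refine Finset.sum_eq_zero fun z hz => ?_
    obtain ⟨-, -, -, h1, h2⟩ := Finset.mem_filter.1 hz
    have key : ∀ j : ℕ, j ≤ N + 1 → part N M z.1 j ≤ 0 := by
      intro j
      induction j with
      | zero => intro _; rw [part_of_nonpos _ (by simp)]
      | succ j ih =>
        intro hj
        have h3 := ih (by omega)
        have h4 := h1 j (by omega) (by omega)
        rw [sub_zero] at h4
        push_cast
        rcases Nat.eq_zero_or_pos j with rfl | hj0
        · rw [part_of_nonpos z.2 (by simp)] at h4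
          linarith
        · have h5 := h2 j (by omega) (by omega)
          rw [add_sub_cancel_right] at h5
          linarith
    have h6 := key (N + 1) le_rfl
    rw [part_of_gt _ (by push_cast; omega)] at h6
    omega

end Burge

namespace Burge

open PowerSeries

/-! ### Gaussian polynomials as power series -/

lemma coe_qFacPoly (n : ℕ) : ((qFacPoly n : Polynomial ℚ) : ℚ⟦X⟧) = qFac n := by
  rw [qFacPoly, qFac, ← Polynomial.coeToPowerSeries.ringHom_apply, map_prod]
  simp

lemma constantCoeff_qFac (n : ℕ) : constantCoeff (qFac n) = 1 := by
  rw [qFac, map_prod]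
  simp

lemma gauss_eq (n m : ℕ) : gauss (n + m) n = ((gaussPoly (n + m) n : Polynomial ℚ) : ℚ⟦X⟧) := by
  have h : constantCoeff (qFac n * qFac m) ≠ 0 := by
    rw [map_mul, constantCoeff_qFac, constantCoeff_qFac]; simp
  rw [gauss, if_pos ⟨by omega, by omega⟩, add_sub_cancel_left, ← Nat.cast_add,
    Int.toNat_natCast, Int.toNat_natCast, Int.toNat_natCast, eq_comm, PowerSeries.eq_mul_inv_iff_mul_eq h,
    ← coe_qFacPoly, ← coe_qFacPoly, ← Polynomial.coe_mul, ← Polynomial.coe_mul, gaussPoly_mul,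
    coe_qFacPoly]

/-! ### Recursion for the sequences of partitions -/

lemma bounds_zero (c : List ℕ) (N M : ℕ) (n : List (List ℕ)) : bounds c N M n 0 = (N, M) := rfl

lemma bounds_cons (c : ℕ) (l : List ℕ) (N M : ℕ) (p : List ℕ) (t : List (List ℕ)) (k : ℕ) :
    bounds (c :: l) N M (p :: t) (k + 1) = bounds l (M - p.sum) ((N :: p).getD c 0) t k := by
  induction k with
  | zero => simp [bounds, parAt, cAt]
  | succ k ih =>
    rw [bounds, ih]
    simp [bounds, parAt, cAt]

/-- The condition on a single partition in `partitionSeqs`. -/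
def IsHead (c N M : ℕ) (p : List ℕ) : Prop :=
  p.length = c ∧ (∀ i < c, (N :: p).getD (i + 1) 0 ≤ (N :: p).getD i 0) ∧ p.sum ≤ M

/-- The condition on the remaining partitions in `partitionSeqs`. -/
def IsTail (l : List ℕ) (N M : ℕ) (t : List (List ℕ)) : Prop :=
  if l = [] then t = [] ∧ N = 0 else t ∈ partitionSeqs l N M

lemma cons_mem_partitionSeqs {c : ℕ} {l : List ℕ} {N M : ℕ} {p : List ℕ} {t : List (List ℕ)} :
    p :: t ∈ partitionSeqs (c :: l) N M ↔
      IsHead c N M p ∧ IsTail l (M - p.sum) ((N :: p).getD c 0) t := by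
  rw [IsTail]
  split_ifs with hl
  · subst hl
    simp only [partitionSeqs, Set.mem_ofPred_eq, List.length_cons, List.length_nil, zero_add,
      Nat.lt_one_iff, forall_eq, IsHead, parAt, cAt, nAt, wAt, bounds, List.getD_cons_zero,
      Nat.sub_self, Nat.add_eq_right, List.length_eq_zero_iff]
    constructor
    · rintro ⟨rfl, h, h'⟩
      exact ⟨h, rfl, by omega⟩
    · rintro ⟨h, rfl, h'⟩
      exact ⟨rfl, h, by have := h.2.2; omega⟩
  · obtain ⟨c', l', rfl⟩ := List.exists_cons_of_ne_nil hl
    simp only [partitionSeqs, Set.mem_ofPred_eq, List.length_cons, Nat.add_right_cancel_iff,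
      Nat.add_sub_cancel, Nat.forall_lt_succ_left' (n := l'.length + 1), nAt, wAt, bounds_cons]
    simp only [IsHead, parAt, cAt, bounds_zero, List.getD_cons_zero, List.getD_cons_succ]
    tauto

lemma exists_cons_of_mem_partitionSeqs {c : ℕ} {l : List ℕ} {N M : ℕ} {n : List (List ℕ)}
    (h : n ∈ partitionSeqs (c :: l) N M) : ∃ p t, n = p :: t := by
  have := h.1
  exact List.exists_cons_of_ne_nil (by rintro rfl; simp at this)

lemma isHead_succ {c N M : ℕ} {p : List ℕ} :
    IsHead (c + 1) N M p ↔ ∃ m p', p = m :: p' ∧ m ≤ min N M ∧ IsHead c m (M - m) p' := by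
  constructor
  · rintro ⟨h1, h2, h3⟩
    obtain ⟨m, p', rfl⟩ := List.exists_cons_of_length_eq_add_one h1
    have h4 : m ≤ N := by simpa using h2 0 (by omega)
    rw [List.sum_cons] at h3
    refine ⟨m, p', rfl, by omega, by simpa using h1, fun i hi => ?_, by omega⟩
    exact h2 (i + 1) (by omega)
  · rintro ⟨m, p', rfl, hm, h1, h2, h3⟩
    refine ⟨by simpa using h1, fun i hi => ?_, by rw [List.sum_cons]; omega⟩
    rcases i with _ | i
    · simp; omega
    · exact h2 i (by omega)

/-- Adjoin a new largest part to the first partition of a sequence. -/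
def consHead (m : ℕ) : List (List ℕ) → List (List ℕ)
  | [] => []
  | p :: t => (m :: p) :: t

lemma consHead_injective (m : ℕ) : Function.Injective (consHead m) := by
  rintro (_ | ⟨p, t⟩) (_ | ⟨p', t'⟩) h <;> simp_all [consHead]

lemma partitionSeqs_succ (c : ℕ) (l : List ℕ) (N M : ℕ) :
    partitionSeqs ((c + 1) :: l) N M =
      ⋃ m ∈ (Finset.range (min N M + 1) : Set ℕ), consHead m '' partitionSeqs (c :: l) m (M - m) := by
  ext n
  simp only [Set.mem_iUnion, Finset.coe_range, Set.mem_Iio, Set.mem_image, exists_prop]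
  constructor
  · intro h
    obtain ⟨p, t, rfl⟩ := exists_cons_of_mem_partitionSeqs h
    obtain ⟨h1, h2⟩ := cons_mem_partitionSeqs.1 h
    obtain ⟨m, p', rfl, hm, h3⟩ := isHead_succ.1 h1
    refine ⟨m, by omega, p' :: t, cons_mem_partitionSeqs.2 ⟨h3, ?_⟩, rfl⟩
    rwa [List.sum_cons, ← Nat.sub_sub, List.getD_cons_succ] at h2
  · rintro ⟨m, hm, n', h, rfl⟩
    obtain ⟨p, t, rfl⟩ := exists_cons_of_mem_partitionSeqs h
    obtain ⟨h1, h2⟩ := cons_mem_partitionSeqs.1 h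
    refine cons_mem_partitionSeqs.2 ⟨isHead_succ.2 ⟨m, p, rfl, by omega, h1⟩, ?_⟩
    rwa [List.sum_cons, ← Nat.sub_sub, List.getD_cons_succ]

lemma partitionSeqs_zero {l : List ℕ} (hl : l ≠ []) (N M : ℕ) :
    partitionSeqs (0 :: l) N M = (List.cons []) '' partitionSeqs l M N := by
  ext n
  have key : ∀ t, [] :: t ∈ partitionSeqs (0 :: l) N M ↔ t ∈ partitionSeqs l M N := by
    intro t
    rw [cons_mem_partitionSeqs, IsTail, if_neg hl]
    simp [IsHead]
  constructor
  · intro h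
    obtain ⟨p, t, rfl⟩ := exists_cons_of_mem_partitionSeqs h
    obtain rfl : p = [] := List.length_eq_zero_iff.1 (cons_mem_partitionSeqs.1 h).1.1
    exact ⟨t, (key t).1 h, rfl⟩
  · rintro ⟨t, ht, rfl⟩
    exact (key t).2 ht

lemma partitionSeqs_singleton_zero (N M : ℕ) :
    partitionSeqs [0] N M = if M = 0 then {[[]]} else ∅ := by
  ext n
  have key : ∀ p t, p :: t ∈ partitionSeqs [0] N M ↔ p = [] ∧ t = [] ∧ M = 0 := by
    intro p t
    rw [cons_mem_partitionSeqs, IsTail, if_pos rfl, IsHead, List.length_eq_zero_iff]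
    constructor
    · rintro ⟨⟨rfl, -⟩, h, h'⟩
      exact ⟨rfl, h, by simpa using h'⟩
    · rintro ⟨rfl, rfl, rfl⟩
      simp
  constructor
  · intro h
    obtain ⟨p, t, rfl⟩ := exists_cons_of_mem_partitionSeqs h
    obtain ⟨rfl, rfl, rfl⟩ := (key p t).1 h
    simp
  · split_ifs with h
    · rintro rfl
      exact (key _ _).2 ⟨rfl, rfl, h⟩
    · exact False.elim

/-! ### Recursion for the fermionic sum -/

/-- The factor of `summand` that comes from a single partition. -/
noncomputable def headSummand (c N M : ℕ) (p : List ℕ) : ℚ⟦X⟧ :=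
  X ^ (∑ i ∈ Finset.range c, (N :: p).getD (i + 1) 0 ^ 2) *
  ∏ i ∈ Finset.range c,
    gauss (2 * ((M : ℤ) - ∑ j ∈ Finset.range (i + 1), ((N :: p).getD (j + 1) 0 : ℤ))
        + ((N :: p).getD i 0 : ℕ) + ((N :: p).getD (i + 1) 0 : ℕ))
      (((N :: p).getD i 0 : ℕ) - ((N :: p).getD (i + 1) 0 : ℕ))

lemma sum_Icc_one {K : Type*} [AddCommMonoid K] (c : ℕ) (f : ℕ → K) :
    ∑ i ∈ Finset.Icc 1 c, f i = ∑ i ∈ Finset.range c, f (i + 1) := by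
  rw [← Finset.Ico_add_one_right_eq_Icc, Finset.sum_Ico_eq_sum_range, Nat.add_sub_cancel]
  exact Finset.sum_congr rfl fun i _ => by rw [add_comm]

lemma prod_Icc_one {K : Type*} [CommMonoid K] (c : ℕ) (f : ℕ → K) :
    ∏ i ∈ Finset.Icc 1 c, f i = ∏ i ∈ Finset.range c, f (i + 1) := by
  rw [← Finset.Ico_add_one_right_eq_Icc, Finset.prod_Ico_eq_prod_range, Nat.add_sub_cancel]
  exact Finset.prod_congr rfl fun i _ => by rw [add_comm]

lemma summand_cons (c : ℕ) (l : List ℕ) (N M : ℕ) (p : List ℕ) (t : List (List ℕ)) :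
    summand (c :: l) N M (p :: t) =
      headSummand c N M p * summand l (M - p.sum) ((N :: p).getD c 0) t := by
  simp only [summand, List.length_cons, Finset.sum_range_succ', Finset.prod_range_succ', headSummand,
    prod_Icc_one, sum_Icc_one, nAt, wAt, bounds_cons, pow_add, Nat.add_sub_cancel]
  simp only [bounds_zero, parAt, cAt, List.getD_cons_zero, List.getD_cons_succ]
  ring

lemma headSummand_succ (c N M m : ℕ) (p : List ℕ) (hm : m ≤ M) :
    headSummand (c + 1) N M (m :: p) =
      X ^ (m ^ 2) * gauss (2 * ((M : ℤ) - m) + N + m) ((N : ℤ) - m) * headSummand c m (M - m) p := by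
  rw [headSummand, headSummand, Finset.sum_range_succ', Finset.prod_range_succ', pow_add]
  simp only [Finset.sum_range_succ' _ (_ + 1), List.getD_cons_zero, List.getD_cons_succ,
    Nat.cast_sub hm]
  have : ∀ i, (M : ℤ) - (∑ j ∈ Finset.range (i + 1), ((p.getD j 0 : ℕ) : ℤ) + m) =
      M - m - ∑ j ∈ Finset.range (i + 1), ((p.getD j 0 : ℕ) : ℤ) := fun i => by ring
  simp only [this]
  simp
  ring

/-- The right-hand side of the identity. -/
noncomputable def fermSum (c : List ℕ) (N M : ℕ) : ℚ⟦X⟧ :=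
  ∑ᶠ n ∈ partitionSeqs c N M, summand c N M n

lemma fermSum_succ (c : ℕ) (l : List ℕ) (N M : ℕ)
    (h : ∀ N M, (partitionSeqs (c :: l) N M).Finite) :
    (partitionSeqs ((c + 1) :: l) N M).Finite ∧
    fermSum ((c + 1) :: l) N M = ∑ m ∈ Finset.range (min N M + 1),
      ((Polynomial.X ^ (m ^ 2) * gaussPoly (2 * M + N - m) (N - m) : Polynomial ℚ) : ℚ⟦X⟧) *
        fermSum (c :: l) m (M - m) := by
  have hfin : ∀ m, (consHead m '' partitionSeqs (c :: l) m (M - m)).Finite :=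
    fun m => (h _ _).image _
  constructor
  · rw [partitionSeqs_succ]
    exact Set.Finite.biUnion (Finset.finite_toSet _) fun m _ => hfin m
  rw [fermSum, partitionSeqs_succ, finsum_mem_biUnion, finsum_mem_coe_finset]
  · refine Finset.sum_congr rfl fun m hm => ?_
    have hm' : m ≤ min N M := by simp at hm; omega
    rw [finsum_mem_image (consHead_injective m).injOn, fermSum, mul_finsum_mem' _ _ (h _ _)]
    refine finsum_mem_congr rfl fun n hn => ?_
    obtain ⟨p, t, rfl⟩ := exists_cons_of_mem_partitionSeqs hn
    have hg := gauss_eq (N - m) (2 * M)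
    rw [show ((N - m : ℕ) : ℤ) + (2 * M : ℕ) = 2 * ((M : ℤ) - m) + N + m by omega,
      show ((N - m : ℕ) : ℤ) = N - m by omega,
      show N - m + 2 * M = 2 * M + N - m by omega] at hg
    rw [consHead, summand_cons, headSummand_succ _ _ _ _ _ (by omega), summand_cons, hg,
      List.sum_cons, ← Nat.sub_sub, List.getD_cons_succ]
    simp only [Polynomial.coe_mul, Polynomial.coe_pow, Polynomial.coe_X]
    ring
  · intro m _ m' _ hne
    refine Set.disjoint_left.2 ?_
    rintro _ ⟨n, hn, rfl⟩ ⟨n', hn', h'⟩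
    obtain ⟨p, t, rfl⟩ := exists_cons_of_mem_partitionSeqs hn
    obtain ⟨p', t', rfl⟩ := exists_cons_of_mem_partitionSeqs hn'
    simp only [consHead, List.cons.injEq] at h'
    exact hne h'.1.1.symm
  · exact Finset.finite_toSet _
  · exact fun m _ => hfin m

lemma fermSum_zero {l : List ℕ} (hl : l ≠ []) (N M : ℕ) (h : (partitionSeqs l M N).Finite) :
    (partitionSeqs (0 :: l) N M).Finite ∧ fermSum (0 :: l) N M = fermSum l M N := by
  rw [partitionSeqs_zero hl]
  refine ⟨h.image _, ?_⟩
  rw [fermSum, partitionSeqs_zero hl, finsum_mem_image List.cons_injective.injOn, fermSum]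
  refine finsum_mem_congr rfl fun n _ => ?_
  rw [summand_cons]
  simp [headSummand]

lemma fermSum_singleton_zero (N M : ℕ) :
    (partitionSeqs [0] N M).Finite ∧ fermSum [0] N M = if M = 0 then 1 else 0 := by
  rw [fermSum, partitionSeqs_singleton_zero]
  split_ifs
  · refine ⟨Set.finite_singleton _, ?_⟩
    rw [finsum_mem_singleton, summand_cons]
    simp [headSummand, summand]
  · exact ⟨Set.finite_empty, finsum_mem_empty⟩

end Burge

namespace Burge

/-! ### Continued fractions -/

/-- The pair of numerator and denominator of a continued fraction. -/
def convergent : List ℕ → ℕ × ℕ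
  | [] => (1, 0)
  | c :: l => (c * (convergent l).1 + (convergent l).2, (convergent l).1)

lemma convergent_contFrac (s r : ℕ) (h : Nat.Coprime s r) : convergent (contFrac s r) = (s, r) := by
  induction r using Nat.strong_induction_on generalizing s with
  | _ r ih =>
    rw [contFrac]
    split_ifs with hr
    · subst hr
      rw [Nat.coprime_zero_right] at h
      simp [convergent, h]
    · have h' : Nat.Coprime r (s % r) := by
        rw [Nat.Coprime, Nat.gcd_comm, ← Nat.gcd_rec, Nat.gcd_comm]
        exact h
      rw [convergent, ih _ (Nat.mod_lt _ (Nat.pos_of_ne_zero hr)) _ h', Nat.div_add_mod']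

lemma convergent_append_one (l : List ℕ) (c : ℕ) :
    convergent (l ++ [c, 1]) = convergent (l ++ [c + 1]) := by
  induction l with
  | nil => simp [convergent]
  | cons c' l ih => simp [convergent, ih]

lemma IsContFrac.convergent_eq {s r : ℕ} {l : List ℕ} (h : IsContFrac s r l) :
    convergent l = (s, r) := by
  obtain ⟨hc, h | ⟨l', c, rfl, h⟩⟩ := h
  · rw [← h, convergent_contFrac s r hc]
  · rw [convergent_append_one, ← h, convergent_contFrac s r hc]

lemma convergent_append (c : List ℕ) (d : ℕ) :
    0 < (convergent (c ++ [d + 2])).1 ∧ 0 < (convergent (c ++ [d + 2])).2 ∧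
    (convergent c).1 ≤ (convergent (c ++ [d + 2])).1 ∧
    (convergent c).2 ≤ (convergent (c ++ [d + 2])).2 ∧
    |((convergent (c ++ [d + 2])).1 : ℤ) * (convergent c).2 -
      (convergent (c ++ [d + 2])).2 * (convergent c).1| = 1 := by
  induction c with
  | nil => simp [convergent]
  | cons c l ih =>
    obtain ⟨h1, h2, h3, h4, h5⟩ := ih
    rw [List.cons_append, convergent, convergent]
    refine ⟨by positivity, h1, ?_, h3, ?_⟩
    · exact Nat.add_le_add (Nat.mul_le_mul_left _ h3) h4
    · rw [← h5, ← abs_neg]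
      push_cast
      congr 1
      ring

/-! ### The identity -/

lemma R_eq_fermSum_cons {a b α β : ℤ} (ha : 0 ≤ a) (hb : 0 ≤ b) (hα : 0 ≤ α) (hβ : 0 ≤ β)
    (hA : 0 < a + b) (hB : 0 < α + β) (l : List ℕ)
    (h0 : ∀ N M, (partitionSeqs (0 :: l) N M).Finite ∧
      ((R N M a b α β : Polynomial ℚ) : PowerSeries ℚ) = fermSum (0 :: l) N M) (c N M : ℕ) :
    (partitionSeqs (c :: l) N M).Finite ∧
      ((R N M a b (α + c * a) (β + c * b) : Polynomial ℚ) : PowerSeries ℚ) =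
        fermSum (c :: l) N M := by
  induction c generalizing N M with
  | zero => simpa using h0 N M
  | succ c ih =>
    obtain ⟨h1, h2⟩ := fermSum_succ c l N M fun N M => (ih N M).1
    refine ⟨h1, ?_⟩
    rw [h2, show α + ((c + 1 : ℕ) : ℤ) * a = α + c * a + a by push_cast; ring,
      show β + ((c + 1 : ℕ) : ℤ) * b = β + c * b + b by push_cast; ring,
      R_transform N M ha hb (by positivity) (by positivity) hA
        (by have : 0 ≤ (c : ℤ) * a := by positivity
            have : 0 ≤ (c : ℤ) * b := by positivity
            linarith),
      ← Polynomial.coeToPowerSeries.ringHom_apply, map_sum]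
    refine Finset.sum_congr rfl fun m _ => ?_
    rw [Polynomial.coeToPowerSeries.ringHom_apply, Polynomial.coe_mul, (ih _ _).2]

theorem R_eq_fermSum (c : List ℕ) (d N M : ℕ) :
    (partitionSeqs (c ++ [d]) N M).Finite ∧
      ((R N M (convergent c).2 ((convergent (c ++ [d + 2])).2 - (convergent c).2) (convergent c).1
        ((convergent (c ++ [d + 2])).1 - (convergent c).1) : Polynomial ℚ) : PowerSeries ℚ) =
          fermSum (c ++ [d]) N M := by
  induction c generalizing N M with
  | nil =>
    have h0 : ∀ N M, (partitionSeqs [0] N M).Finite ∧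
        ((R N M 0 1 1 1 : Polynomial ℚ) : PowerSeries ℚ) = fermSum [0] N M := by
      intro N M
      refine ⟨(fermSum_singleton_zero N M).1, ?_⟩
      rw [(fermSum_singleton_zero N M).2, R_zero_one_one_one]
      split_ifs <;> simp
    have := R_eq_fermSum_cons (by norm_num) (by norm_num) (by norm_num) (by norm_num) (by norm_num)
      (by norm_num) [] h0 d N M
    simp only [convergent, List.nil_append]
    convert this using 4 <;> push_cast <;> ring
  | cons c l ih =>
    obtain ⟨h1, h2, h3, h4, -⟩ := convergent_append l d
    have h0 : ∀ N M, (partitionSeqs (0 :: (l ++ [d])) N M).Finite ∧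
        ((R N M (convergent l).1 ((convergent (l ++ [d + 2])).1 - (convergent l).1) (convergent l).2
          ((convergent (l ++ [d + 2])).2 - (convergent l).2) : Polynomial ℚ) : PowerSeries ℚ) =
            fermSum (0 :: (l ++ [d])) N M := by
      intro N M
      obtain ⟨h5, h6⟩ := fermSum_zero (l := l ++ [d]) (by simp) N M (ih M N).1
      exact ⟨h5, by
        rw [h6, ← (ih M N).2, R_conj M N] <;> omega⟩
    have := R_eq_fermSum_cons (by omega) (by omega) (by omega) (by omega) (by omega) (by omega)
      _ h0 c N M
    rw [List.cons_append, List.cons_append, convergent, convergent]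
    convert this using 4 <;> push_cast <;> ring

end Burge

namespace Burge

open PowerSeries

/-! ### The limit -/

lemma X_pow_dvd_qFac_add_sub (n j : ℕ) : (X : ℚ⟦X⟧) ^ (n + 1) ∣ qFac (n + j) - qFac n := by
  induction j with
  | zero => simp
  | succ j ih =>
    have h : qFac (n + (j + 1)) - qFac n =
        (qFac (n + j) - qFac n) - X ^ (n + 1) * (X ^ j * qFac (n + j)) := by
      rw [← add_assoc, qFac, Finset.prod_range_succ, ← qFac]
      ring
    rw [h]
    exact dvd_sub ih (dvd_mul_right _ _)

open scoped PowerSeries.WithPiTopology in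
lemma X_pow_dvd_qInf_sub (n : ℕ) : (X : ℚ⟦X⟧) ^ (n + 1) ∣ qInf - qFac n := by
  rw [X_pow_dvd_iff]
  intro m hm
  have h1 := (WithPiTopology.multipliable_one_sub_X_pow ℚ).hasProd.tendsto_prod_nat
  have h2 := ((WithPiTopology.continuous_coeff ℚ m).tendsto _).comp h1
  have h3 : Filter.Tendsto (fun k => coeff m (qFac k)) Filter.atTop (nhds (coeff m (qFac n))) := by
    refine tendsto_const_nhds.congr' ?_
    filter_upwards [Filter.eventually_ge_atTop n] with k hk
    obtain ⟨j, rfl⟩ := Nat.exists_eq_add_of_le hk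
    have := X_pow_dvd_iff.1 (X_pow_dvd_qFac_add_sub n j) m hm
    rw [map_sub, sub_eq_zero] at this
    exact this.symm
  rw [map_sub, sub_eq_zero]
  exact tendsto_nhds_unique h2 h3

lemma qInf_mul_inv : qInf * qInf⁻¹ = 1 := by
  refine PowerSeries.mul_inv_cancel _ ?_
  have := X_pow_dvd_iff.1 (X_pow_dvd_qInf_sub 0) 0 (by norm_num)
  rw [map_sub, sub_eq_zero, coeff_zero_eq_constantCoeff_apply, coeff_zero_eq_constantCoeff_apply,
    constantCoeff_qFac] at this
  rw [this]
  exact one_ne_zero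

lemma X_pow_dvd_boxPoly_sub {j : ℕ} {n m : ℤ} (hn : (j : ℤ) ≤ n) (hm : (j : ℤ) ≤ m) :
    (X : ℚ⟦X⟧) ^ (j + 1) ∣ ((boxPoly n m : Polynomial ℚ) : ℚ⟦X⟧) - qInf⁻¹ := by
  lift n to ℕ using by omega
  lift m to ℕ using by omega
  have hq : ∀ k, j ≤ k → (X : ℚ⟦X⟧) ^ (j + 1) ∣ qInf - qFac k := fun k hk =>
    (pow_dvd_pow X (by omega)).trans (X_pow_dvd_qInf_sub k)
  obtain ⟨u, hu⟩ := hq n (by omega)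
  obtain ⟨v, hv⟩ := hq m (by omega)
  obtain ⟨w, hw⟩ := hq (n + m) (by omega)
  have hg := congrArg (fun f : Polynomial ℚ => (f : ℚ⟦X⟧)) (gaussPoly_mul n m)
  simp only [Polynomial.coe_mul, coe_qFacPoly] at hg
  rw [boxPoly_natCast]
  have hI := qInf_mul_inv
  set g : ℚ⟦X⟧ := ((gaussPoly (n + m) n : Polynomial ℚ) : ℚ⟦X⟧)
  have key : g * qInf ^ 2 - qInf = X ^ (j + 1) * (g * (u * qInf + v * qFac n) - w) := by
    linear_combination g * qInf * hu + g * qFac n * hv + hg - hw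
  refine ⟨(g * (u * qInf + v * qFac n) - w) * qInf⁻¹ ^ 2, ?_⟩
  rw [← mul_assoc, ← key]
  linear_combination (-g * (qInf * qInf⁻¹ + 1) + qInf⁻¹) * hI

lemma coeff_X_pow_mul_boxPoly {m e : ℕ} {n₁ m₁ n₂ m₂ : ℤ} (h1 : (m : ℤ) ≤ n₁) (h2 : (m : ℤ) ≤ m₁)
    (h3 : (m : ℤ) ≤ n₂) (h4 : (m : ℤ) ≤ m₂) :
    (Polynomial.X ^ e * (boxPoly n₁ m₁ * boxPoly n₂ m₂)).coeff m =
      coeff m (X ^ e * (qInf⁻¹ * qInf⁻¹)) := by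
  rw [← Polynomial.coeff_coe, Polynomial.coe_mul, Polynomial.coe_mul, Polynomial.coe_pow,
    Polynomial.coe_X, ← sub_eq_zero, ← map_sub]
  refine X_pow_dvd_iff.1 (?_ : X ^ (m + 1) ∣ _) m (by omega)
  obtain ⟨u, hu⟩ := X_pow_dvd_boxPoly_sub h1 h2
  obtain ⟨v, hv⟩ := X_pow_dvd_boxPoly_sub h3 h4
  refine ⟨X ^ e * (u * ((boxPoly n₂ m₂ : Polynomial ℚ) : ℚ⟦X⟧) + v * qInf⁻¹), ?_⟩
  linear_combination X ^ e * ((boxPoly n₂ m₂ : Polynomial ℚ) : ℚ⟦X⟧) * hu + X ^ e * qInf⁻¹ * hv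

section

variable {a b α β : ℤ}

/-- The exponent of a translation. -/
def transExp (A B D k : ℤ) : ℤ := k ^ 2 * (A * B) + k * D

/-- The exponent of a reflection. -/
def reflExp (A B a α k : ℤ) : ℤ := (k * A + a) * (k * B + α)

lemma transExp_nonneg {A B D : ℤ} (h : |D| ≤ A * B) (k : ℤ) : 0 ≤ transExp A B D k := by
  obtain ⟨h1, h2⟩ := abs_le.1 h
  have hAB : 0 ≤ A * B := (abs_nonneg D).trans h
  rw [transExp, show k ^ 2 * (A * B) + k * D = k * (k * (A * B) + D) by ring]
  rcases lt_trichotomy k 0 with hk | rfl | hk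
  · exact mul_nonneg_of_nonpos_of_nonpos hk.le (by nlinarith)
  · simp
  · exact mul_nonneg hk.le (by nlinarith)

lemma reflExp_nonneg {A B a α : ℤ} (ha : 0 ≤ a) (hα : 0 ≤ α) (haA : a ≤ A) (hαB : α ≤ B) (k : ℤ) :
    0 ≤ reflExp A B a α k := by
  rw [reflExp]
  rcases lt_or_ge k 0 with hk | hk
  · exact mul_nonneg_of_nonpos_of_nonpos (by nlinarith) (by nlinarith)
  · have : 0 ≤ A := ha.trans haA
    have : 0 ≤ B := hα.trans hαB
    positivity

/-- The translation terms as polynomials. -/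
noncomputable def transPoly (n m A B D k : ℤ) : Polynomial ℚ :=
  Polynomial.X ^ (transExp A B D k).toNat *
    (boxPoly (n + k * A) (m - k * B) * boxPoly (n - k * A) (m + k * B))

/-- The reflection terms as polynomials. -/
noncomputable def reflPoly (n m A B a α k : ℤ) : Polynomial ℚ :=
  Polynomial.X ^ (reflExp A B a α k).toNat *
    (boxPoly (n - (k * A + a)) (m + (k * B + α)) * boxPoly (n + (k * A + a)) (m - (k * B + α)))

lemma algebraMap_transPoly (n m k : ℤ) {A B : ℤ} (h : |B * a - A * α| ≤ A * B) :
    algebraMap (Polynomial ℚ) (RatFunc ℚ) (transPoly n m A B (B * a - A * α) k) =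
      transTerm a (A - a) α (B - α) n m n m k := by
  rw [transPoly, map_mul, map_mul, map_pow, RatFunc.algebraMap_X, ← zpow_natCast,
    Int.toNat_of_nonneg (transExp_nonneg h k), transTerm_diag, add_sub_cancel, add_sub_cancel,
    transExp, boxRat, boxRat]
  congr 2
  ring

lemma algebraMap_reflPoly (n m k : ℤ) {A B : ℤ} (ha : 0 ≤ a) (hα : 0 ≤ α) (haA : a ≤ A)
    (hαB : α ≤ B) : algebraMap (Polynomial ℚ) (RatFunc ℚ) (reflPoly n m A B a α k) =
      reflTerm a (A - a) α (B - α) n m n m (Equiv.subLeft (-1) k) := by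
  rw [reflPoly, map_mul, map_mul, map_pow, RatFunc.algebraMap_X, ← zpow_natCast,
    Int.toNat_of_nonneg (reflExp_nonneg ha hα haA hαB k), reflTerm_diag, add_sub_cancel,
    add_sub_cancel, reflExp, boxRat, boxRat, Equiv.subLeft_apply]
  congr 1
  · congr 1; ring
  · congr 3 <;> ring

lemma finite_support_transPoly (n m B D : ℤ) {A : ℤ} (hA : 0 < A) :
    (Function.support (transPoly n m A B D)).Finite := by
  refine (Set.finite_Icc (-|n|) |n|).subset fun k hk => ?_
  have h := right_ne_zero_of_mul hk
  refine mem_Icc_of_mul_le hA ?_ ?_ <;> by_contra! hn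
  · exact left_ne_zero_of_mul h (boxPoly_of_neg_left hn _)
  · exact right_ne_zero_of_mul h (boxPoly_of_neg_left hn _)

lemma finite_support_reflPoly (n m B a α : ℤ) {A : ℤ} (hA : 0 < A) :
    (Function.support (reflPoly n m A B a α)).Finite := by
  refine (Set.finite_Icc (-|n + a|) |n - a|).subset fun k hk => ?_
  have h := right_ne_zero_of_mul hk
  refine mem_Icc_of_mul_le hA ?_ ?_ <;> by_contra! hn
  · exact right_ne_zero_of_mul h (boxPoly_of_neg_left (by linarith) _)
  · exact left_ne_zero_of_mul h (boxPoly_of_neg_left (by linarith) _)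

/-- The alternating sum as a sum of polynomials. -/
lemma R_eq_finsum (N M : ℕ) {A B : ℤ} (ha : 0 ≤ a) (hα : 0 ≤ α) (haA : a ≤ A) (hαB : α ≤ B)
    (hA : 0 < A) (hB : 0 < B) (h : |B * a - A * α| ≤ A * B) :
    R N M a (A - a) α (B - α) =
      ∑ᶠ k, transPoly N M A B (B * a - A * α) k - ∑ᶠ k, reflPoly N M A B a α k := by
  apply RatFunc.algebraMap_injective ℚ
  rw [algebraMap_R N M ha (by omega) hα (by omega) (by omega) (by omega), map_sub, altSum,
    ← finsum_comp_equiv (Equiv.subLeft (-1 : ℤ)) (f := reflTerm a (A - a) α (B - α) N M N M),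
    map_finsum _ (finite_support_transPoly N M B _ hA),
    map_finsum _ (finite_support_reflPoly N M B a α hA)]
  congr 1
  · exact finsum_congr fun k => (algebraMap_transPoly _ _ _ h).symm
  · exact finsum_congr fun k => (algebraMap_reflPoly _ _ _ ha hα haA hαB).symm

lemma mem_Icc_of_transExp_le {A B D k : ℤ} {m : ℕ} (hA : 0 < A) (hB : 0 < B) (hD : |D| = 1)
    (h : transExp A B D k ≤ m) : k ∈ Finset.Icc (-(m + 2 : ℤ)) (m + 2) := by
  have h1 : 1 ≤ A * B := by nlinarith
  have h2 : k ^ 2 ≤ k ^ 2 * (A * B) := le_mul_of_one_le_right (sq_nonneg k) h1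
  rw [transExp] at h
  rw [Finset.mem_Icc]
  rcases eq_or_eq_neg_of_abs_eq hD with rfl | rfl
  · constructor <;> by_contra! <;> nlinarith
  · constructor <;> by_contra! <;> nlinarith

lemma mem_Icc_of_reflExp_le {A B a α k : ℤ} {m : ℕ} (hA : 0 < A) (hB : 0 < B) (ha : 0 ≤ a)
    (hα : 0 ≤ α) (haA : a ≤ A) (hαB : α ≤ B) (h : reflExp A B a α k ≤ m) :
    k ∈ Finset.Icc (-(m + 2 : ℤ)) (m + 2) := by
  rw [reflExp] at h
  rw [Finset.mem_Icc]
  constructor <;> by_contra! hk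
  · have h1 : k * A + a ≤ k + 1 := by nlinarith
    have h2 : k * B + α ≤ k + 1 := by nlinarith
    nlinarith
  · have h1 : k ≤ k * A + a := by nlinarith
    have h2 : k ≤ k * B + α := by nlinarith
    nlinarith

lemma coeff_X_pow_mul_of_lt {m e : ℕ} (h : m < e) (f : Polynomial ℚ) :
    (Polynomial.X ^ e * f).coeff m = 0 := by
  rw [Polynomial.coeff_X_pow_mul', if_neg (by omega)]

lemma coeff_R (N M m : ℕ) {A B : ℤ} (ha : 0 ≤ a) (hα : 0 ≤ α) (haA : a ≤ A) (hαB : α ≤ B)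
    (hA : 0 < A) (hB : 0 < B) (h : |B * a - A * α| = 1) :
    (R N M a (A - a) α (B - α)).coeff m = ∑ k ∈ Finset.Icc (-(m + 2 : ℤ)) (m + 2),
      ((transPoly N M A B (B * a - A * α) k).coeff m - (reflPoly N M A B a α k).coeff m) := by
  have hAB : |B * a - A * α| ≤ A * B := by rw [h]; nlinarith
  have f1 := finite_support_transPoly N M B (B * a - A * α) hA
  have f2 := finite_support_reflPoly N M B a α hA
  rw [R_eq_finsum N M ha hα haA hαB hA hB hAB, Polynomial.coeff_sub, Finset.sum_sub_distrib,
    ← Polynomial.lcoeff_apply, ← Polynomial.lcoeff_apply,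
    ← LinearMap.toAddMonoidHom_coe, AddMonoidHom.map_finsum _ f1, AddMonoidHom.map_finsum _ f2,
    finsum_eq_sum_of_support_subset, finsum_eq_sum_of_support_subset]
  · rfl
  · intro k hk
    refine Finset.mem_coe.2 (mem_Icc_of_reflExp_le hA hB ha hα haA hαB (not_lt.1 fun hlt => hk ?_))
    exact coeff_X_pow_mul_of_lt (by omega) _
  · intro k hk
    refine Finset.mem_coe.2 (mem_Icc_of_transExp_le hA hB h (not_lt.1 fun hlt => hk ?_))
    exact coeff_X_pow_mul_of_lt (by omega) _

/-- The numerator of the character, up to degree `m`. -/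
lemma X_pow_dvd_mk_sub (m : ℕ) {A B : ℤ} (ha : 0 ≤ a) (hα : 0 ≤ α) (haA : a ≤ A) (hαB : α ≤ B)
    (hA : 0 < A) (hB : 0 < B) (h : |B * a - A * α| = 1) :
    (X : ℚ⟦X⟧) ^ (m + 1) ∣ (PowerSeries.mk fun j : ℕ => ∑ᶠ k : ℤ,
      ((if transExp A B (B * a - A * α) k = (j : ℤ) then (1 : ℚ) else 0)
        - (if reflExp A B a α k = (j : ℤ) then (1 : ℚ) else 0))) -
      ∑ k ∈ Finset.Icc (-(m + 2 : ℤ)) (m + 2), (X ^ (transExp A B (B * a - A * α) k).toNat -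
        X ^ (reflExp A B a α k).toNat) := by
  have hAB : |B * a - A * α| ≤ A * B := by rw [h]; nlinarith
  rw [X_pow_dvd_iff]
  intro j hj
  rw [map_sub, coeff_mk, map_sum, sub_eq_zero,
    finsum_eq_sum_of_support_subset (s := Finset.Icc (-(m + 2 : ℤ)) (m + 2))]
  · refine Finset.sum_congr rfl fun k _ => ?_
    have h1 := transExp_nonneg hAB k
    have h2 := reflExp_nonneg ha hα haA hαB k
    rw [map_sub, coeff_X_pow, coeff_X_pow]
    congr 1
    · exact if_congr (by omega) rfl rfl
    · exact if_congr (by omega) rfl rfl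
  · intro k hk
    rw [Finset.mem_coe]
    by_contra hk'
    refine hk ?_
    dsimp only
    rw [if_neg, if_neg, sub_zero]
    · exact fun he => hk' (mem_Icc_of_reflExp_le hA hB ha hα haA hαB (by omega))
    · exact fun he => hk' (mem_Icc_of_transExp_le hA hB h (by omega))

lemma abs_mul_add_le {A a k : ℤ} {m : ℕ} (ha : 0 ≤ a) (haA : a ≤ A)
    (hk : k ∈ Finset.Icc (-(m + 2 : ℤ)) (m + 2)) : |k * A + a| ≤ (m + 3) * A := by
  rw [Finset.mem_Icc] at hk
  have hA : 0 ≤ A := ha.trans haA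
  have h1 := mul_le_mul_of_nonneg_right hk.1 hA
  have h2 := mul_le_mul_of_nonneg_right hk.2 hA
  rw [abs_le]
  constructor <;> linarith

lemma eventually_coeff_R (m : ℕ) {A B : ℤ} (ha : 0 ≤ a) (hα : 0 ≤ α) (haA : a ≤ A) (hαB : α ≤ B)
    (hA : 0 < A) (hB : 0 < B) (h : |B * a - A * α| = 1) :
    ∀ᶠ NM : ℕ × ℕ in Filter.atTop, (R NM.1 NM.2 a (A - a) α (B - α)).coeff m =
      coeff m (qInf⁻¹ * (qInf⁻¹ * PowerSeries.mk fun j : ℕ => ∑ᶠ k : ℤ,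
        ((if transExp A B (B * a - A * α) k = (j : ℤ) then (1 : ℚ) else 0)
          - (if reflExp A B a α k = (j : ℤ) then (1 : ℚ) else 0)))) := by
  refine Filter.eventually_atTop.2
    ⟨(m + (m + 3) * A.toNat, m + (m + 3) * B.toNat), fun ⟨N, M⟩ hNM => ?_⟩
  obtain ⟨hN, hM⟩ := Prod.mk_le_mk.1 hNM
  zify at hN hM
  rw [Int.toNat_of_nonneg hA.le] at hN
  rw [Int.toNat_of_nonneg hB.le] at hM
  obtain ⟨u, hu⟩ := X_pow_dvd_mk_sub m ha hα haA hαB hA hB h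
  rw [coeff_R N M m ha hα haA hαB hA hB h, sub_eq_iff_eq_add.1 hu, mul_add, mul_add, map_add,
    X_pow_dvd_iff.1 (⟨qInf⁻¹ * (qInf⁻¹ * u), by ring⟩ :
      X ^ (m + 1) ∣ qInf⁻¹ * (qInf⁻¹ * (X ^ (m + 1) * u))) m (by omega), zero_add,
    Finset.mul_sum, Finset.mul_sum, map_sum]
  refine Finset.sum_congr rfl fun k hk => ?_
  have b1 := abs_le.1 (abs_mul_add_le le_rfl hA.le hk)
  have b2 := abs_le.1 (abs_mul_add_le le_rfl hB.le hk)
  have b3 := abs_le.1 (abs_mul_add_le ha haA hk)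
  have b4 := abs_le.1 (abs_mul_add_le hα hαB hk)
  rw [add_zero] at b1 b2
  rw [transPoly, coeff_X_pow_mul_boxPoly (by linarith) (by linarith) (by linarith) (by linarith),
    reflPoly, coeff_X_pow_mul_boxPoly (by linarith) (by linarith) (by linarith) (by linarith),
    ← map_sub]
  congr 1
  ring

end

end Burge

theorem mainTheorem2 (p p' : ℕ) (hp : 0 < p) (hp' : 0 < p')
    (c : List ℕ) (d : ℕ) (hpp : Burge.IsContFrac p' p (c ++ [d + 2]))
    (r s : ℕ) (hrs : Burge.IsContFrac s r c) :
    |(p' : ℤ) * r - p * s| = 1 ∧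
    (∀ N M : ℕ,
      (Burge.partitionSeqs (c ++ [d]) N M).Finite ∧
      ((Burge.R N M r (p - r) s (p' - s) : Polynomial ℚ) : PowerSeries ℚ) =
        ∑ᶠ n ∈ Burge.partitionSeqs (c ++ [d]) N M, Burge.summand (c ++ [d]) N M n) ∧
    (∀ m : ℕ, ∀ᶠ NM : ℕ × ℕ in Filter.atTop,
      (Burge.R NM.1 NM.2 r (p - r) s (p' - s)).coeff m =
        (PowerSeries.coeff m) ((Burge.qInf)⁻¹ * Burge.virasoroChar p p' r s)) := by
  have h := hpp.convergent_eq
  have h' := hrs.convergent_eq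
  obtain ⟨h1, h2, h3, h4, h5⟩ := Burge.convergent_append c d
  have hR := Burge.R_eq_fermSum c d
  simp only [h, h'] at h1 h2 h3 h4 h5 hR
  refine ⟨h5, hR, fun m => ?_⟩
  exact Burge.eventually_coeff_R m (a := r) (α := s) (A := p) (B := p') (by omega) (by omega)
    (by omega) (by omega) (by omega) (by omega) h5
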